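/- Notation. Subsets of $\omega^\omega$ are called mass problems. For $n\in\omega$ and $f\in\omega^\omega$, $n^\frown f$ is $f$ preceded by $n$; $f\oplus g$ is the function with $(f\oplus g)(2n)=f(n)$, $(f\oplus g)(2n+1)=g(n)$; $f^{[n]}$ is the $n$-th column of $f$ (via a computable pairing); $(\Phi_e)_{e\in\omega}$ is an acceptable numbering of the partial Turing functionals. For mass problems put $\mathcal A\oplus\mathcal B=\{f\oplus g\mid f\in\mathcal A,g\in\mathcal B\}$, $\mathcal A\otimes\mathcal B=0^\frown\mathcal A\cup1^\frown\mathcal B$, $\mathcal A\to\mathcal B=\{e^\frown f\mid \Phi_e(g\oplus f)\in\mathcal B\text{ for all }g\in\mathcal A\}$. $\mathcal A\le_{\mathcal M}\mathcal B$ means that some $\Phi_e$ maps $\mathcal B$ into $\mathcal A$. For families indexed by a set $X$ of (codes of) finite tuples of natural numbers, $(\mathcal A_x)_{x}\le(\mathcal B_x)_{x}$ means that for some $e$ we have $\Phi_e(x^\frown\mathcal B_x)\subseteq\mathcal A_x$ for all $x\in X$. Intervals. A general interval $[(\mathcal B_i)_{i\ge-1},\mathcal A]_{\mathcal P_{\mathcal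 M}}$ is given by mass problems $\mathcal A$ and $(\mathcal B_i)_{i\ge-1}$ such that $(\mathcal A)_{i\in\omega}\ge(\mathcal B_i)_{i\in\omega}\ge(\mathcal B_{-1})_{i\in\omega}$ and $\mathcal B_i\not\ge_{\mathcal M}\mathcal A$ for all $i\ge-1$. For a tuple $a=(a_1,\dots,a_n)$ let $\mathcal B_a=\mathcal B_{-1}\oplus\mathcal B_{a_1}\oplus\dots\oplus\mathcal B_{a_n}$. The base category has the objects $\{1,\dots,m\}^n$ ($m\ge1$) and $\omega^n$; its morphisms are the computable functions $\alpha$ with $(\mathcal B_{\alpha(y)})_y\le(\mathcal B_y)_y$. The fibre over an object $Y$ consists of the families $(\mathcal C_y)_{y\in Y}$ with $(\mathcal B_y)_y\le(\mathcal C_y)_y\le(\mathcal A)_y$, up to equivalence, and $\alpha:Y\to Z$ acts by $(\alpha^*\mathcal C)_y=\mathcal C_{\alpha(y)}\oplus\mathcal B_y$. This is a first-order hyperdoctrine whose fibres are Brouwer algebras. Structures. A structure $\mathfrak M$ in the interval for a first-order language consists of an object $M$, a morphism $M^k\to M$ for each $k$-ary function symbol, and an element of the fibre over $M^k$ for each $k$-ary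 relation symbol. A formula $\varphi$ in the context $x_1,\dots,x_n$ is interpreted by $[\![\varphi]\!]$ in the fibre over $M^n$: $[\![R(\vec t)]\!]=\vec t^{\,*}[\![R]\!]$; $[\![t=s]\!]=(t,s)^*({=_M})$, where $(=_M)_{(b,c)}$ is $\mathcal B_{(b,c)}$ if $b=c$ and $\mathcal A$ otherwise; $\top,\bot,\vee,\wedge$ are interpreted pointwise by $\mathcal B_a$, $\mathcal A$, $\otimes$, $\oplus$; $[\![\varphi\to\psi]\!]_a=([\![\varphi]\!]_a\to[\![\psi]\!]_a)\oplus\mathcal B_a$; $[\![\exists y\,\varphi]\!]_a=\bigcup_{b\in M}b^\frown[\![\varphi]\!]_{(a,b)}$; and $[\![\forall y\,\varphi]\!]_a=\{f\mid f^{[b]}\in\mathcal B_{(a,b)}\to[\![\varphi]\!]_{(a,b)}\text{ for all }b\in M\}\oplus\mathcal B_a$ (the quantifiers are the right and left adjoint of $\pi^*$ for the projection $\pi:M^{n+1}\to M^n$). A sentence is satisfied if its interpretation is the least element of the fibre over $M^0$, and refuted otherwise. Proposition. Consider the language with one nullary relation symbol $R$, one unary relation symbol $S$, and equality. There are a general interval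 $[(\mathcal B_i)_{i\ge-1},\mathcal A]_{\mathcal P_{\mathcal M}}$ and a structure $\mathfrak M$ in it such that $\mathfrak M$ refutes the sentence \[\bigl(\forall x,y,z\,(x=y\vee x=z\vee y=z)\wedge\forall z\,(S(z)\vee R)\bigr)\to\bigl(\forall z\,(S(z))\vee R\bigr).\] -/

import Mathlib

namespace MassProblem

open Encodable
open Nat.Partrec (Code)

/-- The initial segment of `g` of length `s`. -/
def initSeg (g : ℕ → ℕ) (s : ℕ) : List ℕ := (List.range s).map g

/-- The `e`-th partial Turing functional `Φ_e`. On oracle `g` and input `x`, the machine dovetails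
over pairs `t = ⟨k, s⟩`: it runs the `e`-th partial recursive function for `k` steps on the finite
initial segment of `g` of length `s` together with `x`, and outputs the first value found. -/
def turing (e : ℕ) (g : ℕ → ℕ) : ℕ →. ℕ := fun x =>
  Nat.rfindOpt fun t =>
    Code.evaln t.unpair.1 (Denumerable.ofNat Code e)
      (Nat.pair (encode (initSeg g t.unpair.2)) x)

/-- `Φ_e(g) = h`. -/
def Computes (e : ℕ) (g h : ℕ → ℕ) : Prop := ∀ x, h x ∈ turing e g x

/-- `n ⌢ f`. -/
def cons (n : ℕ) (f : ℕ → ℕ) : ℕ → ℕ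
  | 0 => n
  | k + 1 => f k

/-- `f ⊕ g`: `(f ⊕ g)(2n) = f n` and `(f ⊕ g)(2n+1) = g n`. -/
def joinFun (f g : ℕ → ℕ) : ℕ → ℕ := fun n => if n % 2 = 0 then f (n / 2) else g (n / 2)

/-- The `n`-th column `f^{[n]}`, so that `f = ⨁ₙ f^{[n]}`. -/
def col (f : ℕ → ℕ) (n : ℕ) : ℕ → ℕ := fun m => f (Nat.pair n m)

/-- A mass problem: a subset of Baire space. -/
abbrev Problem := Set (ℕ → ℕ)

/-- Medvedev reducibility `A ≤_M B`: `Φ_e(B) ⊆ A` for some `e`. -/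
def MedLE (A B : Problem) : Prop := ∃ e, ∀ f ∈ B, ∃ h ∈ A, Computes e f h

/-- Reducibility of families of mass problems, uniformly in the index:
`Φ_e(x ⌢ B_x) ⊆ A_x` for all `x`, for some `e`. For `X = ℕ` these are the `ω`-mass problems; for
finite `X` this is coordinatewise Medvedev reducibility. -/
def FamLE {X : Type*} [Primcodable X] (A B : X → Problem) : Prop :=
  ∃ e, ∀ x, ∀ f ∈ B x, ∃ h ∈ A x, Computes e (cons (encode x) f) h

/-- The join `A ⊕ B` of mass problems. -/
def join (A B : Problem) : Problem := {h | ∃ f ∈ A, ∃ g ∈ B, h = joinFun f g}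

/-- The meet `A ⊗ B = 0⌢A ∪ 1⌢B`. -/
def meet (A B : Problem) : Problem := {h | (∃ f ∈ A, h = cons 0 f) ∨ ∃ g ∈ B, h = cons 1 g}

/-- The implication `A → B = {e⌢f | Φ_e(g ⊕ f) ∈ B for all g ∈ A}`. -/
def imp (A B : Problem) : Problem :=
  {h | ∃ e f, h = cons e f ∧ ∀ g ∈ A, ∃ b ∈ B, Computes e (joinFun g f) b}

/-- `⨁_{y ∈ Y} A_y`: the column numbered by `y` solves `A_y`. Columns whose number codes no element
of `Y` are arbitrary, which does not change the degree. -/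
def bigJoin {Y : Type*} [Primcodable Y] (A : Y → Problem) : Problem :=
  {f | ∀ y, col f (encode y) ∈ A y}

/-- `⋃_{y ∈ Y} y⌢A_y`. -/
def bigMeet {Y : Type*} [Primcodable Y] (A : Y → Problem) : Problem :=
  {h | ∃ y, ∃ f ∈ A y, h = cons (encode y) f}


/-- The data `A` and `(B_i)_{i ≥ -1}` defining a general interval of the hyperdoctrine of mass
problems: `(A)_i ≥ (B_i)_i ≥ (B_{-1})_i` uniformly in `i ∈ ω`, and no `B_i` with `i ≥ -1` computes
`A`. Here `top` is `A`, `bot` is `B_{-1}` and `dom i` is `B_i`. -/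
structure Interval where
  top : Problem
  bot : Problem
  dom : ℕ → Problem
  bot_le : FamLE (fun _ : ℕ => bot) dom
  le_top : FamLE dom (fun _ : ℕ => top)
  not_top_le_bot : ¬ MedLE top bot
  not_top_le_dom : ∀ i, ¬ MedLE top (dom i)

/-- The underlying sets of the base category: `fin m` is `{1, …, m+1}` and `omega` is `ω`. -/
inductive Base
  | fin (m : ℕ)
  | omega

/-- The elements of a base set; `i : Fin (m+1)` stands for the number `i + 1`. -/
def Base.Pt : Base → Type
  | fin m => Fin (m + 1)
  | omega => ℕ

/-- The natural number that an element of a base set is. -/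
def Base.idx : (b : Base) → b.Pt → ℕ
  | fin _ => fun i => Fin.val i + 1
  | omega => fun i => i

instance : (b : Base) → Primcodable b.Pt
  | .fin m => inferInstanceAs (Primcodable (Fin (m + 1)))
  | .omega => inferInstanceAs (Primcodable ℕ)

/-- An object `{1,…,m}^n` or `ω^n` of the base category. -/
structure Obj where
  base : Base
  dim : ℕ

/-- The points of an object. The `k`-fold power of `M` has points `Fin k → M.Pt`. -/
abbrev Obj.Pt (M : Obj) : Type := Fin M.dim → M.base.Pt

namespace Interval

variable (I : Interval) {M : Obj}

/-- `B_a` for a point `a` of the power `M^k`: the join of `B_{-1}` and of `B_i` for all (finitely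
many) coordinates `i` of `a`. As `B_i ≥ B_{-1}` uniformly, this is `B_{i_1} ⊕ … ⊕ B_{i_n}` up to
equivalence if `a` has coordinates, and `B_{-1}` if it has none. -/
def bottom {k : ℕ} (a : Fin k → M.Pt) : Problem :=
  {f | col f 0 ∈ I.bot ∧ ∀ i j, col f (Nat.pair i j + 1) ∈ I.dom (M.base.idx (a i j))}

/-- `C` is an element of the fibre over `M^k`: `(B_a)_a ≤ C ≤ (A)_a`. -/
def InFibre {k : ℕ} (C : (Fin k → M.Pt) → Problem) : Prop :=
  FamLE I.bottom C ∧ FamLE C (fun _ => I.top)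

/-- Morphisms `M^k → M^l` of the base category: computable functions `α` with `B_{α(a)} ≤ B_a`
uniformly in `a`. -/
def IsMorphism {k l : ℕ} (α : (Fin k → M.Pt) → Fin l → M.Pt) : Prop :=
  Computable α ∧ FamLE (fun a => I.bottom (α a)) I.bottom

/-- The action of the hyperdoctrine on a morphism: `(α^* C)_a = C_{α(a)} ⊕ B_a`. -/
def reindex {k l : ℕ} (α : (Fin k → M.Pt) → Fin l → M.Pt) (C : (Fin l → M.Pt) → Problem) :
    (Fin k → M.Pt) → Problem :=
  fun a => join (C (α a)) (I.bottom a)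

/-- The implication `(C → E) ⊕ B_a` of the fibres. -/
def himp {k : ℕ} (C E : (Fin k → M.Pt) → Problem) : (Fin k → M.Pt) → Problem :=
  fun a => join (imp (C a) (E a)) (I.bottom a)

/-- The universal quantifier over the last variable: `⨁_b (B_{(a,b)} → C_{(a,b)}) ⊕ B_a`. -/
def all {k : ℕ} (C : (Fin (k + 1) → M.Pt) → Problem) : (Fin k → M.Pt) → Problem :=
  fun a => join (bigJoin fun b : M.Pt => imp (I.bottom (Fin.snoc a b : Fin (k + 1) → M.Pt))
    (C (Fin.snoc a b))) (I.bottom a)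

/-- The existential quantifier over the last variable: `⋃_b b⌢C_{(a,b)}`. -/
def ex {k : ℕ} (C : (Fin (k + 1) → M.Pt) → Problem) : (Fin k → M.Pt) → Problem :=
  fun a => bigMeet fun b : M.Pt => C (Fin.snoc a b)

/-- The equality predicate `=_M` in the fibre over `M × M`: bottom on the diagonal, top off it. -/
def eqPred (M : Obj) : (Fin 2 → M.Pt) → Problem :=
  fun a => {f | (a 0 = a 1 ∧ f ∈ I.bottom a) ∨ (a 0 ≠ a 1 ∧ f ∈ I.top)}

end Interval

/-- First-order formulas over `L` (with equality) in the context `x_0, …, x_{n-1}`; a quantifier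
binds the variable `x_n`. -/
inductive Formula (L : FirstOrder.Language) : ℕ → Type _
  | rel {n k : ℕ} (R : L.Relations k) (ts : Fin k → L.Term (Fin n)) : Formula L n
  | eq {n : ℕ} (t s : L.Term (Fin n)) : Formula L n
  | top {n : ℕ} : Formula L n
  | bot {n : ℕ} : Formula L n
  | or {n : ℕ} (φ ψ : Formula L n) : Formula L n
  | and {n : ℕ} (φ ψ : Formula L n) : Formula L n
  | imp {n : ℕ} (φ ψ : Formula L n) : Formula L n
  | ex {n : ℕ} (φ : Formula L (n + 1)) : Formula L n
  | all {n : ℕ} (φ : Formula L (n + 1)) : Formula L n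

/-- A structure for `L` in the hyperdoctrine given by the interval `I`: a universe in the base
category, a morphism for each function symbol and an element of the fibre over `M^k` for each
`k`-ary relation symbol. -/
structure Interval.Struct (I : Interval) (L : FirstOrder.Language) where
  univ : Obj
  funMap {k : ℕ} : L.Functions k → (Fin k → univ.Pt) → univ.Pt
  funMap_mor {k : ℕ} (f : L.Functions k) :
    I.IsMorphism fun (a : Fin k → univ.Pt) (_ : Fin 1) => funMap f a
  relMap {k : ℕ} : L.Relations k → (Fin k → univ.Pt) → Problem
  relMap_mem {k : ℕ} (R : L.Relations k) : I.InFibre (relMap R)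

namespace Interval.Struct

variable {I : Interval} {L : FirstOrder.Language} (M : I.Struct L)

/-- The interpretation of a term in the context `x_0, …, x_{n-1}`. -/
def term {n : ℕ} : L.Term (Fin n) → (Fin n → M.univ.Pt) → M.univ.Pt
  | .var i => fun a => a i
  | .func f ts => fun a => M.funMap f fun i => term (ts i) a

/-- The interpretation `⟦φ⟧` of a formula in the context `x_0, …, x_{n-1}`. -/
def interp : {n : ℕ} → Formula L n → (Fin n → M.univ.Pt) → Problem
  | _, .rel R ts => I.reindex (fun a i => M.term (ts i) a) (M.relMap R)
  | _, .eq t s => I.reindex (fun a => ![M.term t a, M.term s a]) (I.eqPred M.univ)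
  | _, .top => I.bottom
  | _, .bot => fun _ => I.top
  | _, .or φ ψ => fun a => meet (interp φ a) (interp ψ a)
  | _, .and φ ψ => fun a => join (interp φ a) (interp ψ a)
  | _, .imp φ ψ => I.himp (interp φ) (interp ψ)
  | _, .ex φ => ex (interp φ)
  | _, .all φ => I.all (interp φ)

/-- `φ` is satisfied: `⟦φ⟧` is the bottom element of its fibre. -/
def Satisfies {n : ℕ} (φ : Formula L n) : Prop := FamLE (M.interp φ) I.bottom

end Interval.Struct

/-- The relation symbols: a nullary `R` and a unary `S`. -/
inductive CDRel : ℕ → Type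
  | R : CDRel 0
  | S : CDRel 1

/-- The language with a nullary relation `R` and a unary relation `S` (and equality). -/
def cdLang : FirstOrder.Language := ⟨fun _ => Empty, CDRel⟩

/-- The term `x_i`. -/
def cdVar {n : ℕ} (i : Fin n) : cdLang.Term (Fin n) := FirstOrder.Language.Term.var i

/-- The atomic formula `R`. -/
def cdR {n : ℕ} : Formula cdLang n := .rel (k := 0) CDRel.R Fin.elim0

/-- The atomic formula `S(x_i)`. -/
def cdS {n : ℕ} (i : Fin n) : Formula cdLang n := .rel (k := 1) CDRel.S fun _ => cdVar i

/-- The sentence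
`(∀ x y z, (x = y ∨ x = z ∨ y = z)) ∧ (∀ z, (S z ∨ R)) → (∀ z, S z) ∨ R`. -/
def cdFormula : Formula cdLang 0 :=
  .imp
    (.and
      (.all (.all (.all (.or (.eq (cdVar 0) (cdVar 1))
        (.or (.eq (cdVar 0) (cdVar 2)) (.eq (cdVar 1) (cdVar 2)))))))
      (.all (.or (cdS 0) cdR)))
    (.or (.all (cdS 0)) cdR)

/-! ### Facts about the definitions

The remainder proves that `Φ_e` is an acceptable numbering of the Turing functionals, that the
operations above have the universal properties of the connectives, quantifiers and equality of a
first-order hyperdoctrine, and that `⟦φ⟧` lies in its fibre. -/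

/-- `F` is a partial Turing functional, presented by a monotone computable approximation. -/
def IsFunctional {α β : Type*} [Primcodable α] [Primcodable β] (F : (ℕ → ℕ) → α →. β) : Prop :=
  ∃ p : List ℕ → α → Option β, Computable₂ p ∧
    (∀ σ τ a b, σ <+: τ → p σ a = some b → p τ a = some b) ∧
    ∀ g a b, b ∈ F g a ↔ ∃ s, p (initSeg g s) a = some b

theorem initSeg_length (g : ℕ → ℕ) (s : ℕ) : (initSeg g s).length = s := by simp [initSeg]

theorem initSeg_getElem? (g : ℕ → ℕ) (s i b : ℕ) :
    (initSeg g s)[i]? = some b ↔ i < s ∧ g i = b := by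
  simp only [initSeg, List.getElem?_map, Option.map_eq_some_iff, List.getElem?_eq_some_iff]
  simp

theorem initSeg_prefix (g : ℕ → ℕ) {s t : ℕ} (h : s ≤ t) : initSeg g s <+: initSeg g t := by
  have : initSeg g s = (initSeg g t).take s := by
    simp [initSeg, ← List.map_take, List.take_range, h]
  rw [this]; exact List.take_prefix _ _

section
variable {α β γ δ : Type*} [Primcodable α] [Primcodable β] [Primcodable γ] [Primcodable δ]

theorem IsFunctional.of_computable {f : α → β} (hf : Computable f) :
    IsFunctional fun _ a => Part.some (f a) := by
  refine ⟨fun _ a => some (f a), ?_, ?_, ?_⟩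
  · exact (Computable.option_some.comp (hf.comp Computable.snd)).to₂
  · intro _ _ _ _ _ h; exact h
  · intro g a b; simp [eq_comm]

theorem IsFunctional.query : IsFunctional fun (g : ℕ → ℕ) (n : ℕ) => Part.some (g n) := by
  refine ⟨fun σ n => σ[n]?, Computable.list_getElem?, ?_, ?_⟩
  · rintro σ _ n b ⟨ρ, rfl⟩ h
    have := (List.getElem?_eq_some_iff.1 h).1
    simpa [List.getElem?_append_left this] using h
  · intro g n b
    simp only [initSeg_getElem?, Part.mem_some_iff]
    constructor
    · rintro rfl; exact ⟨n + 1, Nat.lt_succ_self _, rfl⟩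
    · rintro ⟨_, _, rfl⟩; rfl

theorem IsFunctional.bind {F : (ℕ → ℕ) → α →. β} {G : (ℕ → ℕ) → α × β →. γ}
    (hF : IsFunctional F) (hG : IsFunctional G) :
    IsFunctional fun g a => (F g a).bind fun b => G g (a, b) := by
  obtain ⟨p, hp, mp, sp⟩ := hF
  obtain ⟨q, hq, mq, sq⟩ := hG
  refine ⟨fun σ a => (p σ a).bind fun b => q σ (a, b), ?_, ?_, ?_⟩
  · have h2 : Computable₂ fun (x : List ℕ × α) (b : β) => q x.1 (x.2, b) :=
      hq.comp (Computable.fst.comp Computable.fst)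
        ((Computable.snd.comp Computable.fst).pair Computable.snd)
    exact (Computable.option_bind (f := fun x : List ℕ × α => p x.1 x.2) hp h2).to₂
  · intro σ τ a c h hc
    simp only [Option.bind_eq_some_iff] at hc ⊢
    obtain ⟨b, h1, h2⟩ := hc
    exact ⟨b, mp _ _ _ _ h h1, mq _ _ _ _ h h2⟩
  · intro g a c
    simp only [Part.mem_bind_iff, Option.bind_eq_some_iff, sp, sq]
    constructor
    · rintro ⟨b, ⟨s, hs⟩, t, ht⟩
      exact ⟨max s t, b, mp _ _ _ _ (initSeg_prefix g (le_max_left _ _)) hs,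
        mq _ _ _ _ (initSeg_prefix g (le_max_right _ _)) ht⟩
    · rintro ⟨s, b, h1, h2⟩
      exact ⟨b, ⟨s, h1⟩, s, h2⟩

theorem IsFunctional.precomp {F : (ℕ → ℕ) → β →. γ} (hF : IsFunctional F) {u : α → β}
    (hu : Computable u) : IsFunctional fun g a => F g (u a) := by
  obtain ⟨p, hp, mp, sp⟩ := hF
  refine ⟨fun σ a => p σ (u a), hp.comp Computable.fst (hu.comp Computable.snd), ?_, ?_⟩
  · intro σ τ a b; exact mp _ _ _ _
  · intro g a b; exact sp _ _ _

theorem IsFunctional.cond {F G : (ℕ → ℕ) → α →. β} (hF : IsFunctional F) (hG : IsFunctional G)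
    {c : α → Bool} (hc : Computable c) :
    IsFunctional fun g a => bif c a then F g a else G g a := by
  obtain ⟨p, hp, mp, sp⟩ := hF
  obtain ⟨q, hq, mq, sq⟩ := hG
  refine ⟨fun σ a => bif c a then p σ a else q σ a, ?_, ?_, ?_⟩
  · exact (Computable.cond (hc.comp Computable.snd) hp hq).to₂
  · intro σ τ a b h; dsimp only; cases c a
    · exact mq _ _ _ _ h
    · exact mp _ _ _ _ h
  · intro g a b; dsimp only; cases c a
    · exact sq _ _ _
    · exact sp _ _ _

theorem IsFunctional.ofOption {F : (ℕ → ℕ) → α →. β} (hF : IsFunctional F) {u : γ → Option α}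
    (hu : Computable u) : IsFunctional fun g c => (u c : Part α).bind fun a => F g a := by
  obtain ⟨p, hp, mp, sp⟩ := hF
  refine ⟨fun σ c => (u c).bind (p σ), ?_, ?_, ?_⟩
  · have h2 : Computable₂ fun (x : List ℕ × γ) (a : α) => p x.1 a :=
      hp.comp (Computable.fst.comp Computable.fst) Computable.snd
    exact (Computable.option_bind (f := fun x : List ℕ × γ => u x.2)
      (hu.comp Computable.snd) h2).to₂
  · intro σ τ c b h
    dsimp only
    cases hc : u c with
    | none => simp
    | some a => simpa using mp _ _ _ _ h
  · intro g c b
    dsimp only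
    cases hc : u c with
    | none => exact iff_of_false (by rw [Part.coe_none, Part.bind_none]; simp) (by simp)
    | some a => rw [Part.coe_some, Part.bind_some]; simpa using sp g a b

/-- The values `G(c,0), G(c,1), …` found by the approximation `q`. -/
def build (q : List ℕ → γ × ℕ → Option ℕ) (σ : List ℕ) (c : γ) (k : ℕ) : List ℕ :=
  Nat.rec [] (fun _ l => Option.casesOn (q σ (c, l.length)) l fun v => l ++ [v]) k

theorem build_good {γ : Type*} (q : List ℕ → γ × ℕ → Option ℕ) (σ : List ℕ) (c : γ) (k : ℕ) :
    ∀ i (h : i < (build q σ c k).length), q σ (c, i) = some (build q σ c k)[i] := by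
  induction k with
  | zero => intro i h; simp [build] at h
  | succ k ih =>
    have e : build q σ c (k + 1) = Option.casesOn (q σ (c, (build q σ c k).length))
      (build q σ c k) fun v => build q σ c k ++ [v] := rfl
    cases hq : q σ (c, (build q σ c k).length) with
    | none => rw [hq] at e; simp only at e; simpa only [e] using ih
    | some v =>
      rw [hq] at e; simp only at e
      intro i h
      simp only [e] at h ⊢
      rw [List.getElem_append]
      split
      · exact ih i _
      · have : i = (build q σ c k).length := by simp at h; omega
        subst this; simpa using hq

theorem build_length_mono {γ : Type*} (q : List ℕ → γ × ℕ → Option ℕ)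
    (mq : ∀ σ τ a b, σ <+: τ → q σ a = some b → q τ a = some b) {σ τ : List ℕ} (hσ : σ <+: τ)
    (c : γ) (k : ℕ) : (build q σ c k).length ≤ (build q τ c k).length := by
  induction k with
  | zero => simp [build]
  | succ k ih =>
    have e : ∀ ρ, build q ρ c (k + 1) = Option.casesOn (q ρ (c, (build q ρ c k).length))
      (build q ρ c k) fun v => build q ρ c k ++ [v] := fun _ => rfl
    rw [e, e]
    rcases ih.lt_or_eq with h | h
    · cases q σ (c, (build q σ c k).length) <;> cases q τ (c, (build q τ c k).length) <;>
        simp <;> omega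
    · cases hs : q σ (c, (build q σ c k).length) with
      | none => cases q τ (c, (build q τ c k).length) <;> simp <;> omega
      | some v => rw [← h, mq _ _ _ _ hσ hs]; simp [h]

theorem build_length_succ {γ : Type*} (q : List ℕ → γ × ℕ → Option ℕ) (σ : List ℕ) (c : γ) {k l : ℕ}
    (h : k ≤ l) : (build q σ c k).length ≤ (build q σ c l).length := by
  induction l, h using Nat.le_induction with
  | base => exact le_rfl
  | succ l _ ih =>
    have e : build q σ c (l + 1) = Option.casesOn (q σ (c, (build q σ c l).length))
      (build q σ c l) fun v => build q σ c l ++ [v] := rfl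
    rw [e]; cases q σ (c, (build q σ c l).length) <;> simp <;> omega

theorem prefix_of_getElem {l m : List ℕ} (h : l.length ≤ m.length)
    (H : ∀ i (h1 : i < l.length) (h2 : i < m.length), l[i] = m[i]) : l <+: m := by
  have : l = m.take l.length := by
    apply List.ext_getElem
    · simp [h]
    · intro i h1 h2; simpa using H i h1 _
  rw [this]; exact List.take_prefix _ _

/-- Composition: a functional may be run on an oracle that is itself computed. -/
theorem IsFunctional.subst {F : (ℕ → ℕ) → α →. β} {G : (ℕ → ℕ) → γ × ℕ →. ℕ}
    (hF : IsFunctional F) (hG : IsFunctional G) :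
    ∃ K : (ℕ → ℕ) → γ × α →. β, IsFunctional K ∧
      ∀ g c h, (∀ n, h n ∈ G g (c, n)) → ∀ a b, b ∈ F h a → b ∈ K g (c, a) := by
  obtain ⟨p, hp, mp, sp⟩ := hF
  obtain ⟨q, hq, mq, sq⟩ := hG
  have hb : Computable fun x : List ℕ × γ × α => build q x.1 x.2.1 x.1.length := by
    unfold build
    refine Computable.nat_rec (Computable.list_length.comp Computable.fst) (Computable.const [])
      (h := fun (x : List ℕ × γ × α) (y : ℕ × List ℕ) =>
        Option.casesOn (q x.1 (x.2.1, y.2.length)) y.2 fun v => y.2 ++ [v]) ?_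
    refine Computable.option_casesOn
      (o := fun z : (List ℕ × γ × α) × ℕ × List ℕ => q z.1.1 (z.1.2.1, z.2.2.length)) ?_ ?_ ?_
    · exact hq.comp (Computable.fst.comp Computable.fst)
        ((Computable.fst.comp (Computable.snd.comp Computable.fst)).pair
          (Computable.list_length.comp (Computable.snd.comp Computable.snd)))
    · exact Computable.snd.comp Computable.snd
    · exact Computable.list_concat.comp
        (Computable.snd.comp (Computable.snd.comp Computable.fst)) Computable.snd
  have mono : ∀ σ τ (c : γ), σ <+: τ → build q σ c σ.length <+: build q τ c τ.length := by
    intro σ τ c h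
    have hl := (build_length_mono q mq h c σ.length).trans (build_length_succ q τ c h.length_le)
    refine prefix_of_getElem hl ?_
    intro i h1 h2
    have e1 := mq _ _ _ _ h (build_good q σ c _ i h1)
    have e2 := build_good q τ c _ i h2
    exact Option.some.inj (e1.symm.trans e2)
  refine ⟨fun g x => ⟨∃ b, ∃ s, p (build q (initSeg g s) x.1 s) x.2 = some b,
    fun h => h.choose⟩, ⟨fun σ x => p (build q σ x.1 σ.length) x.2, ?_, ?_, ?_⟩, ?_⟩
  · exact hp.comp hb (Computable.snd.comp Computable.snd)
  · intro σ τ x b h; exact mp _ _ _ _ (mono _ _ _ h)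
  · intro g x b
    have uniq : ∀ s t b b', p (build q (initSeg g s) x.1 s) x.2 = some b →
        p (build q (initSeg g t) x.1 t) x.2 = some b' → b = b' := by
      intro s t b b' h1 h2
      have k1 := mono _ _ x.1 (initSeg_prefix g (le_max_left s t))
      have k2 := mono _ _ x.1 (initSeg_prefix g (le_max_right s t))
      simp only [initSeg_length] at k1 k2
      exact Option.some.inj ((mp _ _ _ _ k1 h1).symm.trans (mp _ _ _ _ k2 h2))
    simp only [initSeg_length]
    constructor
    · rintro ⟨h, rfl⟩; exact h.choose_spec
    · rintro ⟨s, hs⟩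
      refine ⟨⟨b, s, hs⟩, ?_⟩
      have h : ∃ b, ∃ s, p (build q (initSeg g s) x.1 s) x.2 = some b := ⟨b, s, hs⟩
      obtain ⟨t, ht⟩ := h.choose_spec
      exact uniq _ _ _ _ ht hs
  · intro g c h hh a b hb
    obtain ⟨s, hs⟩ := (sp _ _ _).1 hb
    have step : ∃ t, s ≤ (build q (initSeg g t) c t).length := by
      have : ∃ t, s ≤ t ∧ ∀ n < s, q (initSeg g t) (c, n) = some (h n) := by
        clear hs
        induction s with
        | zero => exact ⟨0, le_rfl, by simp⟩
        | succ s ih =>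
          obtain ⟨t, hst, ht⟩ := ih
          obtain ⟨r, hr⟩ := (sq _ _ _).1 (hh s)
          refine ⟨max (t + 1) r, by omega, fun n hn => ?_⟩
          rcases Nat.lt_succ_iff_lt_or_eq.1 hn with h1 | rfl
          · exact mq _ _ _ _ (initSeg_prefix g (by omega)) (ht n h1)
          · exact mq _ _ _ _ (initSeg_prefix g (by omega)) hr
      obtain ⟨t, hst, ht⟩ := this
      refine ⟨t, ?_⟩
      have : ∀ k ≤ s, k ≤ (build q (initSeg g t) c k).length := by
        intro k
        induction k with
        | zero => simp
        | succ k ih =>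
          intro hk
          have ih := ih (by omega)
          have e : build q (initSeg g t) c (k + 1) =
            Option.casesOn (q (initSeg g t) (c, (build q (initSeg g t) c k).length))
              (build q (initSeg g t) c k) fun v => build q (initSeg g t) c k ++ [v] := rfl
          rw [e]
          rcases ih.lt_or_eq with h1 | h1
          · cases q (initSeg g t) (c, (build q (initSeg g t) c k).length) <;> simp <;> omega
          · rw [← h1, ht k (by omega)]; simp [← h1]
      exact (this s le_rfl).trans (build_length_succ _ _ _ hst)
    obtain ⟨t, ht⟩ := step
    have hpre : initSeg h s <+: build q (initSeg g t) c t := by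
      refine prefix_of_getElem (by simpa [initSeg_length] using ht) ?_
      intro i h1 h2
      have e1 := build_good q (initSeg g t) c t i h2
      have e2 := (sq _ _ _).2 ⟨t, e1⟩
      have e3 := Part.mem_unique e2 (hh i)
      rw [e3]; simp [initSeg]
    have hfin := mp _ _ _ _ hpre hs
    have hex : ∃ b, ∃ s, p (build q (initSeg g s) c s) a = some b := ⟨b, t, hfin⟩
    refine ⟨hex, ?_⟩
    obtain ⟨r, hr⟩ := hex.choose_spec
    have k1 := mono _ _ c (initSeg_prefix g (le_max_left r t))
    have k2 := mono _ _ c (initSeg_prefix g (le_max_right r t))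
    simp only [initSeg_length] at k1 k2
    exact Option.some.inj ((mp _ _ _ _ k1 hr).symm.trans (mp _ _ _ _ k2 hfin))

end

/-- The universal functional. -/
theorem IsFunctional.turing : IsFunctional fun g (x : ℕ × ℕ) => turing x.1 g x.2 := by
  let body : List ℕ → ℕ × ℕ → ℕ → Option ℕ := fun σ x t =>
    Code.evaln t.unpair.1 (Denumerable.ofNat Code x.1)
      (Nat.pair (encode (σ.take t.unpair.2)) x.2)
  let go : List ℕ → ℕ × ℕ → ℕ → Option ℕ := fun σ x k =>
    Nat.rec none (fun t r => Option.casesOn r (body σ x t) some) k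
  have hstep : ∀ σ x k, go σ x (k + 1) = Option.casesOn (go σ x k) (body σ x k) some :=
    fun _ _ _ => rfl
  have hgo : ∀ σ x k b, go σ x k = some b ↔
      ∃ t < k, body σ x t = some b ∧ ∀ u < t, body σ x u = none := by
    intro σ x k
    have key : (go σ x k = none ∧ ∀ u < k, body σ x u = none) ∨
        ∃ b, go σ x k = some b ∧ ∃ t < k, body σ x t = some b ∧ ∀ u < t, body σ x u = none := by
      induction k with
      | zero => left; exact ⟨rfl, by simp⟩
      | succ k ih =>
        rcases ih with ⟨h1, h2⟩ | ⟨b, h1, t, ht, h3, h4⟩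
        · cases hb : body σ x k with
          | none =>
            left; refine ⟨by rw [hstep, h1]; exact hb, fun u hu => ?_⟩
            rcases Nat.lt_succ_iff_lt_or_eq.1 hu with h | rfl
            · exact h2 u h
            · exact hb
          | some b => right; exact ⟨b, by rw [hstep, h1]; exact hb, k, by omega, hb, h2⟩
        · right; exact ⟨b, by rw [hstep, h1], t, by omega, h3, h4⟩
    intro b
    rcases key with ⟨h1, h2⟩ | ⟨b', h1, t, ht, h3, h4⟩
    · rw [h1]; simp only [reduceCtorEq, false_iff]
      rintro ⟨t, ht, h3, -⟩; rw [h2 t ht] at h3; cases h3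
    · rw [h1]; constructor
      · intro e; cases e; exact ⟨t, ht, h3, h4⟩
      · rintro ⟨u, hu, h5, h6⟩
        rcases lt_trichotomy t u with h | rfl | h
        · rw [h6 t h] at h3; cases h3
        · rw [← h3, h5]
        · rw [h4 u h] at h5; cases h5
  have hbody : ∀ σ τ x t, σ <+: τ → t < σ.length → body τ x t = body σ x t := by
    rintro σ _ x t ⟨ρ, rfl⟩ ht
    have : t.unpair.2 ≤ σ.length := (Nat.unpair_right_le t).trans ht.le
    simp only [body, List.take_append_of_le_length this]
  have hcomp : Computable₂ fun σ x => go σ x σ.length := by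
    refine Computable.nat_rec (f := fun y : List ℕ × ℕ × ℕ => y.1.length)
      (Computable.list_length.comp Computable.fst) (Computable.const none)
      (h := fun (y : List ℕ × ℕ × ℕ) (z : ℕ × Option ℕ) =>
        Option.casesOn z.2 (body y.1 y.2 z.1) some) ?_
    refine Computable.option_casesOn
      (o := fun z : (List ℕ × ℕ × ℕ) × ℕ × Option ℕ => z.2.2)
      (Computable.snd.comp Computable.snd) ?_ (Computable.option_some.comp Computable.snd)
    have hun : Computable fun z : (List ℕ × ℕ × ℕ) × ℕ × Option ℕ => z.2.1.unpair :=
      Computable.unpair.comp (Computable.fst.comp Computable.snd)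
    have htake : Computable₂ (List.take : ℕ → List ℕ → List ℕ) := Primrec.list_take.to_comp
    refine Computable.comp (g := fun z : (List ℕ × ℕ × ℕ) × ℕ × Option ℕ =>
        ((z.2.1.unpair.1, Denumerable.ofNat Code z.1.2.1),
          Nat.pair (encode (z.1.1.take z.2.1.unpair.2)) z.1.2.2)) Code.primrec_evaln.to_comp ?_
    exact (((Computable.fst.comp hun).pair ((Computable.ofNat Code).comp
        (Computable.fst.comp (Computable.snd.comp Computable.fst)))).pair
        ((Primrec₂.natPair.to_comp).comp
          (Computable.encode.comp (htake.comp (Computable.snd.comp hun)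
            (Computable.fst.comp Computable.fst)))
          (Computable.snd.comp (Computable.snd.comp Computable.fst))))
  have hb : ∀ g x s t, t < s → body (initSeg g s) x t = Code.evaln t.unpair.1
      (Denumerable.ofNat Code x.1) (Nat.pair (encode (initSeg g t.unpair.2)) x.2) := by
    intro g x s t h
    have h' : t.unpair.2 ≤ s := (Nat.unpair_right_le t).trans h.le
    have : (initSeg g s).take t.unpair.2 = initSeg g t.unpair.2 := by
      simp [initSeg, ← List.map_take, List.take_range, h']
    simp only [body, this]
  clear_value go body
  refine ⟨fun σ x => go σ x σ.length, hcomp, ?_, ?_⟩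
  · intro σ τ x b h hb
    obtain ⟨t, ht, h1, h2⟩ := (hgo _ _ _ _).1 hb
    refine (hgo _ _ _ _).2 ⟨t, ht.trans_le h.length_le, ?_, fun u hu => ?_⟩
    · rw [hbody _ _ _ _ h ht, h1]
    · rw [hbody _ _ _ _ h (hu.trans ht), h2 u hu]
  · intro g x b
    simp only [hgo, initSeg_length, MassProblem.turing]
    replace hb := hb g x
    generalize hf : (fun t : ℕ => Code.evaln t.unpair.1
        (Denumerable.ofNat Code x.1) (Nat.pair (encode (initSeg g t.unpair.2)) x.2)) = f
    replace hb : ∀ s t, t < s → body (initSeg g s) x t = f t := by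
      intro s t h; rw [hb s t h, ← hf]
    have hmem : b ∈ Nat.rfindOpt f ↔ ∃ t, f t = some b ∧ ∀ u < t, f u = none := by
      constructor
      · intro h
        simp only [Nat.rfindOpt, Part.mem_bind_iff, Part.mem_coe] at h
        obtain ⟨t, h1, h2⟩ := h
        refine ⟨t, h2, fun u hu => ?_⟩
        have := Nat.rfind_min h1 hu
        simpa using this
      · rintro ⟨t, h1, h2⟩
        simp only [Nat.rfindOpt, Part.mem_bind_iff, Part.mem_coe]
        refine ⟨t, ?_, h1⟩
        refine Nat.mem_rfind.2 ⟨by simp [h1], fun {m} hm => by simp [h2 m hm]⟩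
    rw [hmem]
    constructor
    · rintro ⟨t, h1, h2⟩
      exact ⟨t + 1, t, by omega, by rw [hb _ _ (by omega), h1],
        fun u hu => by rw [hb _ _ (by omega), h2 u hu]⟩
    · rintro ⟨s, t, ht, h1, h2⟩
      exact ⟨t, by rw [← hb s t ht, h1], fun u hu => by rw [← hb s u (by omega), h2 u hu]⟩

/-- Every functional with a parameter has indices that are computable in the parameter. -/
theorem IsFunctional.index {γ : Type*} [Primcodable γ] {F : (ℕ → ℕ) → γ × ℕ →. ℕ}
    (hF : IsFunctional F) : ∃ φ : γ → ℕ, Computable φ ∧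
      ∀ g c n b, b ∈ F g (c, n) → b ∈ MassProblem.turing (φ c) g n := by
  obtain ⟨p, hp, mp, sp⟩ := hF
  -- input `⟨encode c, ⟨encode σ, n⟩⟩`
  let r : ℕ → Option ℕ := fun z => (decode (α := γ × List ℕ × ℕ) z).bind fun y =>
    p y.2.1 (y.1, y.2.2)
  have hr : Computable r := by
    refine Computable.option_bind Computable.decode ?_
    exact hp.comp (Computable.fst.comp (Computable.snd.comp Computable.snd))
      ((Computable.fst.comp Computable.snd).pair
        (Computable.snd.comp (Computable.snd.comp Computable.snd)))
  obtain ⟨c₀, hc₀⟩ := Code.exists_code.1 (Partrec.nat_iff.1 hr.ofOption)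
  refine ⟨fun c => encode (Code.curry c₀ (encode c)), ?_, ?_⟩
  · exact Computable.encode.comp
      ((Code.primrec₂_curry.to_comp).comp (Computable.const c₀) Computable.encode)
  · intro g c n b hb
    obtain ⟨s, hs⟩ := (sp _ _ _).1 hb
    have hval : ∀ s v, v ∈ Code.eval (Code.curry c₀ (encode c)) (Nat.pair (encode (initSeg g s)) n)
        ↔ p (initSeg g s) (c, n) = some v := by
      intro s v
      rw [Code.eval_curry, hc₀]
      have : Nat.pair (encode c) (Nat.pair (encode (initSeg g s)) n)
          = encode (c, initSeg g s, n) := by simp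
      simp only [r, this, encodek]
      simp
    obtain ⟨k, hk⟩ := Code.evaln_complete.1 ((hval s b).2 hs)
    simp only [MassProblem.turing, Denumerable.ofNat_encode]
    have hdom : (Nat.rfindOpt fun t => Code.evaln t.unpair.1 (Code.curry c₀ (encode c))
        (Nat.pair (encode (initSeg g t.unpair.2)) n)).Dom :=
      Nat.rfindOpt_dom.2 ⟨Nat.pair k s, b, by simpa using hk⟩
    obtain ⟨b', hb'⟩ := Part.dom_iff_mem.1 hdom
    obtain ⟨t, ht⟩ := Nat.rfindOpt_spec hb'
    have h' := (hval _ _).1 (Code.evaln_sound ht)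
    have := Part.mem_unique ((sp g (c, n) b').2 ⟨_, h'⟩) hb
    rwa [← this]

section
variable {α β γ δ : Type*} [Primcodable α] [Primcodable β] [Primcodable γ] [Primcodable δ]

theorem IsFunctional.read {u : γ → ℕ} {v : γ × ℕ → β} (hu : Computable u) (hv : Computable v) :
    IsFunctional fun g c => Part.some (v (c, g (u c))) := by
  have h := (IsFunctional.query.precomp hu).bind (IsFunctional.of_computable hv)
  simpa only [Part.bind_some] using h

/-- The functional with output `F ⊕ G`. -/
def joinPF (F G : (ℕ → ℕ) → γ × ℕ →. ℕ) : (ℕ → ℕ) → γ × ℕ →. ℕ := fun g x =>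
  bif x.2 % 2 == 0 then F g (x.1, x.2 / 2) else G g (x.1, x.2 / 2)

/-- The functional with output `u ⌢ F`. -/
def consPF (u : γ → ℕ) (F : (ℕ → ℕ) → γ × ℕ →. ℕ) : (ℕ → ℕ) → γ × ℕ →. ℕ := fun g x =>
  bif x.2 == 0 then Part.some (u x.1) else F g (x.1, x.2 - 1)

/-- The functional that reads its oracle at `u`. -/
def readPF (γ : Type*) (u : ℕ → ℕ) : (ℕ → ℕ) → γ × ℕ →. ℕ := fun g x => Part.some (g (u x.2))

theorem IsFunctional.joinPF {F G : (ℕ → ℕ) → γ × ℕ →. ℕ} (hF : IsFunctional F)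
    (hG : IsFunctional G) :
    IsFunctional (joinPF F G) := by
  have h : Computable fun x : γ × ℕ => (x.1, x.2 / 2) :=
    Computable.fst.pair ((Primrec.nat_div.to_comp).comp Computable.snd (Computable.const 2))
  refine IsFunctional.cond (hF.precomp h) (hG.precomp h) ?_
  exact (Primrec.beq.to_comp).comp
    ((Primrec.nat_mod.to_comp).comp Computable.snd (Computable.const 2)) (Computable.const 0)

theorem mem_joinPF {γ : Type*} {F G : (ℕ → ℕ) → γ × ℕ →. ℕ} {g a b : ℕ → ℕ} {c : γ}
    (ha : ∀ n, a n ∈ F g (c, n)) (hb : ∀ n, b n ∈ G g (c, n)) (n : ℕ) :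
    joinFun a b n ∈ joinPF F G g (c, n) := by
  rcases Nat.mod_two_eq_zero_or_one n with h | h
  · simp [joinFun, joinPF, h, ha]
  · simp [joinFun, joinPF, h, hb]

theorem IsFunctional.consPF {u : γ → ℕ} (hu : Computable u) {F : (ℕ → ℕ) → γ × ℕ →. ℕ}
    (hF : IsFunctional F) :
    IsFunctional (consPF u F) := by
  refine IsFunctional.cond (.of_computable (hu.comp Computable.fst)) (hF.precomp ?_) ?_
  · exact Computable.fst.pair (Computable.pred.comp Computable.snd)
  · exact (Primrec.beq.to_comp).comp Computable.snd (Computable.const 0)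

theorem mem_consPF {γ : Type*} {u : γ → ℕ} {F : (ℕ → ℕ) → γ × ℕ →. ℕ} {g a : ℕ → ℕ} {c : γ}
    (ha : ∀ n, a n ∈ F g (c, n)) (n : ℕ) :
    cons (u c) a n ∈ consPF u F g (c, n) := by
  cases n with
  | zero => simp [cons, consPF]
  | succ n => simpa [cons, consPF] using ha n

@[simp] theorem mem_readPF {γ : Type*} {u : ℕ → ℕ} {g : ℕ → ℕ} {c : γ} {n m : ℕ} :
    m ∈ readPF γ u g (c, n) ↔ m = g (u n) := by simp [readPF]

theorem IsFunctional.readPF {u : ℕ → ℕ} (hu : Computable u) : IsFunctional (readPF γ u) :=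
  IsFunctional.read (v := fun y : (γ × ℕ) × ℕ => y.2) (hu.comp Computable.snd) Computable.snd

theorem IsFunctional.readId : IsFunctional (MassProblem.readPF γ id) := .readPF Computable.id

theorem IsFunctional.readSucc : IsFunctional (MassProblem.readPF γ Nat.succ) :=
  .readPF Computable.succ

theorem computable_even : Computable fun n : ℕ => 2 * n :=
  (Primrec.nat_mul.to_comp).comp (Computable.const 2) Computable.id

theorem computable_odd : Computable fun n : ℕ => 2 * n + 1 :=
  Computable.succ.comp computable_even

theorem IsFunctional.readEven : IsFunctional (MassProblem.readPF γ fun n => 2 * n) :=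
  .readPF computable_even

theorem IsFunctional.readOdd : IsFunctional (MassProblem.readPF γ fun n => 2 * n + 1) :=
  .readPF computable_odd

end

@[simp] theorem joinFun_even (a b : ℕ → ℕ) (n : ℕ) : joinFun a b (2 * n) = a n := by
  simp [joinFun]

@[simp] theorem joinFun_odd (a b : ℕ → ℕ) (n : ℕ) : joinFun a b (2 * n + 1) = b n := by
  have h1 : (2 * n + 1) % 2 = 1 := by omega
  have h2 : (2 * n + 1) / 2 = n := by omega
  simp [joinFun, h1, h2]

@[simp] theorem cons_zero (n : ℕ) (f : ℕ → ℕ) : cons n f 0 = n := rfl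

@[simp] theorem cons_succ (n : ℕ) (f : ℕ → ℕ) (k : ℕ) : cons n f (k + 1) = f k := rfl

section
variable {X Y : Type*} [Primcodable X] [Primcodable Y] {A B C D : X → Problem}

/-- Uniform reducibility in terms of functionals with a parameter. -/
theorem famLE_iff : FamLE A B ↔ ∃ F : (ℕ → ℕ) → X × ℕ →. ℕ, IsFunctional F ∧
    ∀ x, ∀ f ∈ B x, ∃ h ∈ A x, ∀ k, h k ∈ F f (x, k) := by
  constructor
  · rintro ⟨e, he⟩
    have hT : IsFunctional fun g (n : ℕ) => turing e g n :=
      IsFunctional.turing.precomp (u := fun n => (e, n))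
        ((Computable.const e).pair Computable.id)
    obtain ⟨K, hK, H⟩ := hT.subst
      (IsFunctional.consPF (γ := X) (u := encode) Computable.encode IsFunctional.readId)
    refine ⟨K, hK, fun x f hf => ?_⟩
    obtain ⟨h, hh, hc⟩ := he x f hf
    refine ⟨h, hh, fun k => H f x (cons (encode x) f) ?_ k (h k) (hc k)⟩
    exact mem_consPF (u := encode) (by simp)
  · rintro ⟨F, hF, H⟩
    obtain ⟨K, hK, HK⟩ := hF.subst (IsFunctional.readSucc (γ := Unit))
    have hr : IsFunctional fun g (_ : Unit × ℕ) => Part.some (g 0) :=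
      IsFunctional.read (v := fun y : (Unit × ℕ) × ℕ => y.2) (Computable.const 0) Computable.snd
    have hd : Computable fun z : (Unit × ℕ) × ℕ => (decode (α := X) z.2).map
        fun x => ((), (x, z.1.2)) :=
      Computable.option_map (Computable.decode.comp Computable.snd)
        ((Computable.const ()).pair (Computable.snd.pair
          (Computable.snd.comp (Computable.fst.comp Computable.fst))))
    have h1 := hr.bind (hK.ofOption hd)
    obtain ⟨φ, -, hφ⟩ := h1.index
    refine ⟨φ (), fun x f hf => ?_⟩
    obtain ⟨h, hh, hc⟩ := H x f hf
    refine ⟨h, hh, fun k => hφ _ _ _ _ ?_⟩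
    have := HK (cons (encode x) f) () f (fun n => by simp) (x, k) (h k) (hc k)
    simpa using this

theorem FamLE.of {F : (ℕ → ℕ) → X × ℕ →. ℕ} (hF : IsFunctional F)
    (H : ∀ x, ∀ f ∈ B x, ∃ h ∈ A x, ∀ k, h k ∈ F f (x, k)) : FamLE A B :=
  famLE_iff.2 ⟨F, hF, H⟩

theorem FamLE.refl (A : X → Problem) : FamLE A A :=
  .of IsFunctional.readId fun _ f hf => ⟨f, hf, by simp⟩

theorem FamLE.trans (h₁ : FamLE A B) (h₂ : FamLE B C) : FamLE A C := by
  obtain ⟨F, hF, H⟩ := famLE_iff.1 h₁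
  obtain ⟨G, hG, H'⟩ := famLE_iff.1 h₂
  obtain ⟨K, hK, HK⟩ := hF.subst hG
  refine .of (F := fun g x => K g (x.1, x)) (hK.precomp (Computable.fst.pair Computable.id)) ?_
  intro x f hf
  obtain ⟨g, hg, hgc⟩ := H' x f hf
  obtain ⟨h, hh, hc⟩ := H x g hg
  exact ⟨h, hh, fun k => HK f x g hgc (x, k) _ (hc k)⟩

theorem FamLE.comap (h : FamLE A B) {u : Y → X} (hu : Computable u) :
    FamLE (fun y => A (u y)) fun y => B (u y) := by
  obtain ⟨F, hF, H⟩ := famLE_iff.1 h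
  refine .of (hF.precomp (u := fun y : Y × ℕ => (u y.1, y.2))
    ((hu.comp Computable.fst).pair Computable.snd)) ?_
  intro y f hf
  exact H (u y) f hf

theorem FamLE.join_left (A B : X → Problem) : FamLE A fun x => join (A x) (B x) := by
  refine .of IsFunctional.readEven ?_
  rintro x _ ⟨f, hf, g, hg, rfl⟩
  exact ⟨f, hf, fun k => by simp⟩

theorem FamLE.join_right (A B : X → Problem) : FamLE B fun x => join (A x) (B x) := by
  refine .of IsFunctional.readOdd ?_
  rintro x _ ⟨f, hf, g, hg, rfl⟩
  exact ⟨g, hg, fun k => by simp⟩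

theorem FamLE.join (h₁ : FamLE A C) (h₂ : FamLE B C) :
    FamLE (fun x => MassProblem.join (A x) (B x)) C := by
  obtain ⟨F, hF, H⟩ := famLE_iff.1 h₁
  obtain ⟨G, hG, H'⟩ := famLE_iff.1 h₂
  refine .of (hF.joinPF hG) fun x f hf => ?_
  obtain ⟨a, ha, hac⟩ := H x f hf
  obtain ⟨b, hb, hbc⟩ := H' x f hf
  exact ⟨_, ⟨a, ha, b, hb, rfl⟩, mem_joinPF hac hbc⟩

theorem FamLE.meet_left (A B : X → Problem) : FamLE (fun x => meet (A x) (B x)) A :=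
  .of (IsFunctional.consPF (Computable.const 0) IsFunctional.readId) fun _ f hf =>
    ⟨cons 0 f, .inl ⟨f, hf, rfl⟩, mem_consPF (u := fun _ => 0) (by simp)⟩

theorem FamLE.meet_right (A B : X → Problem) : FamLE (fun x => meet (A x) (B x)) B :=
  .of (IsFunctional.consPF (Computable.const 1) IsFunctional.readId) fun _ f hf =>
    ⟨cons 1 f, .inr ⟨f, hf, rfl⟩, mem_consPF (u := fun _ => 1) (by simp)⟩

theorem FamLE.meet (h₁ : FamLE C A) (h₂ : FamLE C B) :
    FamLE C fun x => MassProblem.meet (A x) (B x) := by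
  obtain ⟨F, hF, H⟩ := famLE_iff.1 h₁
  obtain ⟨G, hG, H'⟩ := famLE_iff.1 h₂
  obtain ⟨F', hF', HF⟩ := hF.subst (IsFunctional.readSucc (γ := Unit))
  obtain ⟨G', hG', HG⟩ := hG.subst (IsFunctional.readSucc (γ := Unit))
  have hu : Computable fun z : (X × ℕ) × ℕ => ((), z.1) :=
    (Computable.const ()).pair Computable.fst
  have hr : IsFunctional fun g (_ : X × ℕ) => Part.some (g 0) :=
    IsFunctional.read (v := fun y : (X × ℕ) × ℕ => y.2) (Computable.const 0) Computable.snd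
  have hc : Computable fun z : (X × ℕ) × ℕ => z.2 == 0 :=
    (Primrec.beq.to_comp).comp Computable.snd (Computable.const 0)
  refine .of (hr.bind ((hF'.precomp hu).cond (hG'.precomp hu) hc)) ?_
  rintro x _ (⟨f, hf, rfl⟩ | ⟨f, hf, rfl⟩)
  · obtain ⟨h, hh, hk⟩ := H x f hf
    exact ⟨h, hh, fun k => by simpa using HF (cons 0 f) () f (by simp) (x, k) _ (hk k)⟩
  · obtain ⟨h, hh, hk⟩ := H' x f hf
    exact ⟨h, hh, fun k => by simpa using HG (cons 1 f) () f (by simp) (x, k) _ (hk k)⟩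

/-- `A → C` is the least `D` with `A ⊕ D ≥ C`. -/
theorem famLE_imp_iff : FamLE (fun x => imp (A x) (C x)) D ↔
    FamLE C fun x => join (A x) (D x) := by
  constructor
  · intro h
    obtain ⟨F, hF, H⟩ := famLE_iff.1 h
    obtain ⟨F', hF', HF⟩ := hF.subst (IsFunctional.readOdd (γ := Unit))
    have hF1 : IsFunctional fun g (x : X × ℕ) => F' g ((), (x.1, x.2 + 1)) :=
      hF'.precomp ((Computable.const ()).pair
        (Computable.fst.pair (Computable.succ.comp Computable.snd)))
    have hF0 : IsFunctional fun g (x : X × ℕ) => F' g ((), (x.1, 0)) :=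
      hF'.precomp ((Computable.const ()).pair (Computable.fst.pair (Computable.const 0)))
    obtain ⟨U, hU, HU⟩ := IsFunctional.turing.subst (IsFunctional.readEven.joinPF hF1)
    refine .of (hF0.bind (hU.precomp (u := fun z : (X × ℕ) × ℕ => (z.1.1, (z.2, z.1.2))) ?_)) ?_
    · exact (Computable.fst.comp Computable.fst).pair
        (Computable.snd.pair (Computable.snd.comp Computable.fst))
    · rintro x _ ⟨a, ha, d, hd, rfl⟩
      obtain ⟨_, ⟨e, f, rfl, he⟩, hk⟩ := H x d hd
      obtain ⟨c, hc, hcc⟩ := he a ha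
      have hk' : ∀ n, cons e f n ∈ F' (joinFun a d) ((), (x, n)) := fun n =>
        HF (joinFun a d) () d (by simp) (x, n) _ (hk n)
      refine ⟨c, hc, fun n => Part.mem_bind_iff.2 ⟨e, hk' 0, ?_⟩⟩
      refine HU (joinFun a d) x (joinFun a f) ?_ (e, n) _ (hcc n)
      exact mem_joinPF (by simp) fun n => hk' (n + 1)
  · intro h
    obtain ⟨F, hF, H⟩ := famLE_iff.1 h
    obtain ⟨φ, hφ, Hφ⟩ := hF.index
    refine .of (IsFunctional.consPF hφ IsFunctional.readId) fun x d hd => ?_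
    refine ⟨cons (φ x) d, ⟨φ x, d, rfl, fun a ha => ?_⟩, mem_consPF (u := φ) (by simp)⟩
    obtain ⟨c, hc, hk⟩ := H x (joinFun a d) ⟨a, ha, d, hd, rfl⟩
    exact ⟨c, hc, fun n => Hφ _ _ _ _ (hk n)⟩

/-- `⨁` is left adjoint to weakening. -/
theorem famLE_bigJoin_iff {E : X × Y → Problem} :
    FamLE (fun x => bigJoin fun y => E (x, y)) D ↔ FamLE E fun z => D z.1 := by
  constructor
  · intro h
    obtain ⟨F, hF, H⟩ := famLE_iff.1 h
    refine .of (hF.precomp (u := fun z : (X × Y) × ℕ => (z.1.1, Nat.pair (encode z.1.2) z.2)) ?_) ?_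
    · exact (Computable.fst.comp Computable.fst).pair ((Primrec₂.natPair.to_comp).comp
        (Computable.encode.comp (Computable.snd.comp Computable.fst)) Computable.snd)
    · rintro ⟨x, y⟩ d hd
      obtain ⟨f, hf, hk⟩ := H x d hd
      exact ⟨_, hf y, fun k => hk _⟩
  · intro h
    obtain ⟨F, hF, H⟩ := famLE_iff.1 h
    have hd : Computable fun z : X × ℕ => (decode (α := Y) z.2.unpair.1).map fun y =>
        ((z.1, y), z.2.unpair.2) := by
      have hun : Computable fun z : X × ℕ => z.2.unpair := Computable.unpair.comp Computable.snd
      exact Computable.option_map (Computable.decode.comp (Computable.fst.comp hun))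
        (((Computable.fst.comp Computable.fst).pair Computable.snd).pair
          (Computable.snd.comp (hun.comp Computable.fst)))
    have hcond : Computable fun z : X × ℕ => (decode (α := Y) z.2.unpair.1).isSome :=
      (Primrec.option_isSome.to_comp).comp
        (Computable.decode.comp (Computable.fst.comp (Computable.unpair.comp Computable.snd)))
    refine .of ((hF.ofOption hd).cond (.of_computable (Computable.const 0)) hcond) ?_
    intro x d hd
    choose h hh hk using fun y => H (x, y) d hd
    refine ⟨fun n => (decode (α := Y) n.unpair.1).elim 0 fun y => h y n.unpair.2, ?_, ?_⟩
    · intro y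
      have : col (fun n => (decode (α := Y) n.unpair.1).elim 0 fun y => h y n.unpair.2)
          (encode y) = h y := by
        funext m; simp [col]
      rw [this]; exact hh y
    · intro n
      cases hn : decode (α := Y) n.unpair.1 with
      | none => simp [hn]
      | some y => simpa [hn] using hk y n.unpair.2

/-- `⋃ y⌢-` is right adjoint to weakening. -/
theorem famLE_bigMeet_iff {E : X × Y → Problem} :
    FamLE D (fun x => bigMeet fun y => E (x, y)) ↔ FamLE (fun z => D z.1) E := by
  constructor
  · intro h
    obtain ⟨F, hF, H⟩ := famLE_iff.1 h
    obtain ⟨K, hK, HK⟩ := hF.subst (IsFunctional.consPF (γ := X × Y) (u := fun z => encode z.2)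
      (Computable.encode.comp Computable.snd) IsFunctional.readId)
    refine .of (hK.precomp (u := fun z : (X × Y) × ℕ => (z.1, (z.1.1, z.2))) ?_) ?_
    · exact Computable.fst.pair ((Computable.fst.comp Computable.fst).pair Computable.snd)
    · rintro ⟨x, y⟩ f hf
      obtain ⟨h, hh, hk⟩ := H x (cons (encode y) f) ⟨y, f, hf, rfl⟩
      refine ⟨h, hh, fun n => HK f (x, y) (cons (encode y) f) ?_ (x, n) _ (hk n)⟩
      exact mem_consPF (γ := X × Y) (u := fun z => encode z.2) (by simp)
  · intro h
    obtain ⟨F, hF, H⟩ := famLE_iff.1 h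
    obtain ⟨K, hK, HK⟩ := hF.subst (IsFunctional.readSucc (γ := Unit))
    have hr : IsFunctional fun g (_ : X × ℕ) => Part.some (g 0) :=
      IsFunctional.read (v := fun y : (X × ℕ) × ℕ => y.2) (Computable.const 0) Computable.snd
    have hd : Computable fun z : (X × ℕ) × ℕ => (decode (α := Y) z.2).map fun y =>
        ((), ((z.1.1, y), z.1.2)) :=
      Computable.option_map (Computable.decode.comp Computable.snd)
        ((Computable.const ()).pair (((Computable.fst.comp (Computable.fst.comp
          Computable.fst)).pair Computable.snd).pair
          (Computable.snd.comp (Computable.fst.comp Computable.fst))))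
    refine .of (hr.bind (hK.ofOption hd)) ?_
    rintro x _ ⟨y, f, hf, rfl⟩
    obtain ⟨h, hh, hk⟩ := H (x, y) f hf
    exact ⟨h, hh, fun n => by
      simpa using HK (cons (encode y) f) () f (by simp) ((x, y), n) _ (hk n)⟩

end

section
variable {X : Type*} [Primcodable X] {A B C : X → Problem}

theorem FamLE.mono {A' B' : X → Problem} (h : FamLE A B) (hA : ∀ x, A x ⊆ A' x)
    (hB : ∀ x, B' x ⊆ B x) : FamLE A' B' := by
  obtain ⟨e, he⟩ := h
  exact ⟨e, fun x f hf => (he x f (hB x hf)).imp fun _ h => ⟨hA x h.1, h.2⟩⟩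

theorem FamLE.cases {c : X → Bool} (hc : Computable c)
    (h₁ : FamLE A fun x => {f | f ∈ B x ∧ c x = true})
    (h₂ : FamLE A fun x => {f | f ∈ B x ∧ c x = false}) : FamLE A B := by
  obtain ⟨F, hF, H⟩ := famLE_iff.1 h₁
  obtain ⟨G, hG, H'⟩ := famLE_iff.1 h₂
  refine .of (hF.cond hG (hc.comp Computable.fst)) fun x f hf => ?_
  cases h : c x with
  | true => simpa [h] using H x f ⟨hf, h⟩
  | false => simpa [h] using H' x f ⟨hf, h⟩

end

section
variable {P : Type*} [Primcodable P]

theorem computable_tuple {α : Type*} [Primcodable α] {n : ℕ} {t : Fin n → α → P}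
    (h : ∀ i, Computable (t i)) : Computable fun a i => t i a := by
  have h1 : Computable fun a => List.Vector.ofFn fun i => t i a := Computable.vector_ofFn h
  have h2 : Primrec fun (v : List.Vector P n) (i : Fin n) => v.get i :=
    Primrec.fin_curry.2 Primrec.vector_get
  exact (h2.to_comp.comp h1).of_eq fun a => funext fun i => by simp

theorem computable_coord {n : ℕ} (i : Fin n) : Computable fun a : Fin n → P => a i :=
  Computable.fin_app.comp Computable.id (Computable.const i)

theorem computable_snoc {n : ℕ} :
    Computable fun z : (Fin n → P) × P => (Fin.snoc z.1 z.2 : Fin (n + 1) → P) := by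
  refine computable_tuple (t := fun i (z : (Fin n → P) × P) =>
    (Fin.snoc z.1 z.2 : Fin (n + 1) → P) i) fun i => ?_
  refine Fin.lastCases ?_ (fun i => ?_) i
  · simpa using Computable.snd
  · simpa using (computable_coord i).comp Computable.fst

theorem computable_split {n : ℕ} :
    Computable fun a : Fin (n + 1) → P => ((Fin.init a : Fin n → P), a (Fin.last n)) :=
  (computable_tuple fun i => computable_coord i.castSucc).pair (computable_coord _)

theorem famLE_snoc_iff {n : ℕ} {A B : (Fin (n + 1) → P) → Problem} :
    FamLE (fun z : (Fin n → P) × P => A (Fin.snoc z.1 z.2)) (fun z => B (Fin.snoc z.1 z.2)) ↔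
      FamLE A B := by
  refine ⟨fun h => ?_, fun h => h.comap computable_snoc⟩
  simpa using h.comap computable_split

end

namespace Interval

variable (I : Interval) {M : Obj}

theorem himp_le_iff {k : ℕ} {C E D : (Fin k → M.Pt) → Problem} (hD : FamLE I.bottom D) :
    FamLE (I.himp C E) D ↔ FamLE E fun a => join (C a) (D a) :=
  ⟨fun h => famLE_imp_iff.1 ((FamLE.join_left _ _).trans h),
    fun h => (famLE_imp_iff.2 h).join hD⟩

/-- `all` is left adjoint to reindexing along the projection. -/
theorem all_le_iff {k : ℕ} {C : (Fin (k + 1) → M.Pt) → Problem} {D : (Fin k → M.Pt) → Problem}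
    (hD : FamLE I.bottom D) :
    FamLE (I.all C) D ↔ FamLE C (I.reindex (fun a => Fin.init a) D) := by
  have h1 : FamLE (I.all C) D ↔ FamLE (fun a => bigJoin fun b : M.Pt =>
      imp (I.bottom (Fin.snoc a b : Fin (k + 1) → M.Pt)) (C (Fin.snoc a b))) D :=
    ⟨fun h => (FamLE.join_left _ _).trans h, fun h => h.join hD⟩
  rw [h1]
  refine (famLE_bigJoin_iff (E := fun z : (Fin k → M.Pt) × M.Pt =>
    imp (I.bottom (Fin.snoc z.1 z.2 : Fin (k + 1) → M.Pt)) (C (Fin.snoc z.1 z.2)))).trans ?_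
  refine famLE_imp_iff.trans ?_
  rw [← famLE_snoc_iff (A := C)]
  have comm : ∀ U V : (Fin k → M.Pt) × M.Pt → Problem,
      FamLE (fun z => join (U z) (V z)) fun z => join (V z) (U z) :=
    fun U V => (FamLE.join_right _ _).join (FamLE.join_left _ _)
  simp only [reindex, Fin.init_snoc]
  exact ⟨fun h => h.trans (comm _ _), fun h => h.trans (comm _ _)⟩

/-- `ex` is right adjoint to reindexing along the projection. -/
theorem le_ex_iff {k : ℕ} {C : (Fin (k + 1) → M.Pt) → Problem} {D : (Fin k → M.Pt) → Problem}
    (hC : FamLE I.bottom C) :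
    FamLE D (ex C) ↔ FamLE (I.reindex (fun a => Fin.init a) D) C := by
  refine (famLE_bigMeet_iff (E := fun z : (Fin k → M.Pt) × M.Pt =>
    C (Fin.snoc z.1 z.2))).trans ?_
  have h1 : FamLE (fun a : Fin (k + 1) → M.Pt => D (Fin.init a)) C ↔
      FamLE (I.reindex (fun a => Fin.init a) D) C :=
    ⟨fun h => h.join hC, fun h => (FamLE.join_left _ _).trans h⟩
  rw [← h1, ← famLE_snoc_iff]
  simp only [Fin.init_snoc]

/-- `B_{(a_{r(1)},…,a_{r(l)})} ≤ B_a` uniformly. -/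
theorem bottom_rename {k l : ℕ} (r : Fin l → Fin k) :
    FamLE (fun a : Fin k → M.Pt => I.bottom fun i => a (r i)) I.bottom := by
  let ρ : ℕ → ℕ := fun i => ((List.ofFn fun i => (r i : ℕ))[i]?).getD 0
  have hρ : Computable ρ := Computable.option_getD
    (Computable.list_getElem?.comp (Computable.const _) Computable.id) (Computable.const 0)
  have hρ' : ∀ i : Fin l, ρ i = r i := fun i => by simp [ρ]
  let u : ℕ → ℕ := fun n => Nat.casesOn n.unpair.1 n fun q =>
    Nat.pair (Nat.pair (ρ q.unpair.1) q.unpair.2 + 1) n.unpair.2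
  have hu : Computable u := by
    have pair := Primrec₂.natPair.to_comp
    have hq : Computable fun z : ℕ × ℕ => z.2.unpair := Computable.unpair.comp Computable.snd
    refine Computable.nat_casesOn (f := fun n : ℕ => n.unpair.1)
      (h := fun n q => Nat.pair (Nat.pair (ρ q.unpair.1) q.unpair.2 + 1) n.unpair.2)
      (Computable.fst.comp Computable.unpair) Computable.id ?_
    exact pair.comp (Computable.succ.comp (pair.comp (hρ.comp (Computable.fst.comp hq))
      (Computable.snd.comp hq))) (Computable.snd.comp (Computable.unpair.comp Computable.fst))
  refine .of (IsFunctional.readPF hu) fun a f hf => ⟨fun n => f (u n), ⟨?_, fun i j => ?_⟩, by simp⟩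
  · have : col (fun n => f (u n)) 0 = col f 0 := by funext m; simp [col, u]
    rw [this]; exact hf.1
  · have : col (fun n => f (u n)) (Nat.pair i j + 1) = col f (Nat.pair (r i) j + 1) := by
      funext m; simp [col, u, hρ']
    rw [this]; exact hf.2 _ _

/-- The bottom of each fibre lies below its top. -/
theorem bottom_le_top (k : ℕ) : FamLE (I.bottom (M := M) (k := k)) fun _ => I.top := by
  have h0 : FamLE (fun _ : ℕ => I.bot) fun _ => I.top := I.bot_le.trans I.le_top
  obtain ⟨F, hF, H⟩ := famLE_iff.1 h0
  obtain ⟨G, hG, H'⟩ := famLE_iff.1 I.le_top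
  have hidx : Computable M.base.idx := by
    cases h : M.base with
    | fin m => exact Computable.succ.comp (Primrec.fin_val (n := m + 1)).to_comp
    | omega => exact Computable.id
  -- the index of the coordinate `(i, j)` of `a`
  let v : (Fin k → M.Pt) × ℕ → ℕ := fun z =>
    ((decode (α := Fin k) z.2.unpair.1).bind fun i =>
      (decode (α := Fin M.dim) z.2.unpair.2).map fun j => M.base.idx (z.1 i j)).getD 0
  have hv : Computable v := by
    have hun : Computable fun z : (Fin k → M.Pt) × ℕ => z.2.unpair :=
      Computable.unpair.comp Computable.snd
    refine Computable.option_getD (Computable.option_bind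
      (Computable.decode.comp (Computable.fst.comp hun)) ?_) (Computable.const 0)
    refine Computable.option_map (f := fun z : ((Fin k → M.Pt) × ℕ) × Fin k =>
      decode (α := Fin M.dim) z.1.2.unpair.2)
      (Computable.decode.comp (Computable.snd.comp (hun.comp Computable.fst))) ?_
    exact hidx.comp (Computable.fin_app.comp (Computable.fin_app.comp
      (Computable.fst.comp (Computable.fst.comp Computable.fst))
      (Computable.snd.comp Computable.fst)) Computable.snd)
  have hv' : ∀ (a : Fin k → M.Pt) (i : Fin k) (j : Fin M.dim), v (a, Nat.pair i j) = M.base.idx (a i j) := by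
    intro a i j
    have e1 : decode (α := Fin k) (i : ℕ) = some i := encodek i
    have e2 : decode (α := Fin M.dim) (j : ℕ) = some j := encodek j
    simp [v, e1, e2]
  have hun : Computable fun z : (Fin k → M.Pt) × ℕ => z.2.unpair :=
    Computable.unpair.comp Computable.snd
  have h1 := hF.precomp (u := fun z : (Fin k → M.Pt) × ℕ => (0, z.2.unpair.2))
    ((Computable.const 0).pair (Computable.snd.comp hun))
  have h2 := hG.precomp (u := fun z : (Fin k → M.Pt) × ℕ =>
    (v (z.1, z.2.unpair.1 - 1), z.2.unpair.2))
    ((hv.comp (Computable.fst.pair (Computable.pred.comp (Computable.fst.comp hun)))).pair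
      (Computable.snd.comp hun))
  have hc : Computable fun z : (Fin k → M.Pt) × ℕ => z.2.unpair.1 == 0 :=
    (Primrec.beq.to_comp).comp (Computable.fst.comp hun) (Computable.const 0)
  refine .of (h1.cond h2 hc) fun a f hf => ?_
  obtain ⟨p, hp, hpc⟩ := H 0 f hf
  choose q hq hqc using fun n => H' n f hf
  refine ⟨fun n => Nat.casesOn n.unpair.1 (p n.unpair.2) fun c => q (v (a, c)) n.unpair.2,
    ⟨?_, fun i j => ?_⟩, fun n => ?_⟩
  · have : col (fun n : ℕ => (Nat.casesOn n.unpair.1 (p n.unpair.2) fun c =>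
        q (v (a, c)) n.unpair.2 : ℕ)) 0 = p := by funext m; simp [col]
    rw [this]; exact hp
  · have : col (fun n : ℕ => (Nat.casesOn n.unpair.1 (p n.unpair.2) fun c =>
        q (v (a, c)) n.unpair.2 : ℕ)) (Nat.pair i j + 1) = q (M.base.idx (a i j)) := by
      funext m; simp [col, hv']
    rw [this]; exact hq _
  · cases hn : n.unpair.1 with
    | zero => simpa [hn] using hpc n.unpair.2
    | succ c => simpa [hn] using hqc (v (a, c)) n.unpair.2

theorem InFibre.bottom (k : ℕ) : I.InFibre (I.bottom (M := M) (k := k)) :=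
  ⟨FamLE.refl _, I.bottom_le_top k⟩

theorem InFibre.top (k : ℕ) : I.InFibre (M := M) (k := k) fun _ => I.top :=
  ⟨I.bottom_le_top k, FamLE.refl _⟩

variable {I}

theorem InFibre.reindex {k l : ℕ} {C : (Fin l → M.Pt) → Problem} (hC : I.InFibre C)
    {α : (Fin k → M.Pt) → Fin l → M.Pt} (hα : Computable α) : I.InFibre (I.reindex α C) :=
  ⟨FamLE.join_right _ _, (hC.2.comap hα).join (I.bottom_le_top k)⟩

theorem InFibre.join {k : ℕ} {C E : (Fin k → M.Pt) → Problem} (hC : I.InFibre C)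
    (hE : I.InFibre E) : I.InFibre fun a => MassProblem.join (C a) (E a) :=
  ⟨hC.1.trans (FamLE.join_left _ _), hC.2.join hE.2⟩

theorem InFibre.meet {k : ℕ} {C E : (Fin k → M.Pt) → Problem} (hC : I.InFibre C)
    (hE : I.InFibre E) : I.InFibre fun a => MassProblem.meet (C a) (E a) :=
  ⟨hC.1.meet hE.1, (FamLE.meet_left _ _).trans hC.2⟩

theorem InFibre.himp {k : ℕ} {C E : (Fin k → M.Pt) → Problem}
    (hE : I.InFibre E) : I.InFibre (I.himp C E) :=
  ⟨FamLE.join_right _ _,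
    (I.himp_le_iff (I.bottom_le_top k)).2 (hE.2.trans (FamLE.join_right _ _))⟩

theorem InFibre.all {k : ℕ} {C : (Fin (k + 1) → M.Pt) → Problem} (hC : I.InFibre C) :
    I.InFibre (I.all C) :=
  ⟨FamLE.join_right _ _,
    (I.all_le_iff (I.bottom_le_top k)).2 (hC.2.trans (FamLE.join_left _ _))⟩

theorem InFibre.ex {k : ℕ} {C : (Fin (k + 1) → M.Pt) → Problem} (hC : I.InFibre C) :
    I.InFibre (Interval.ex C) := by
  constructor
  · exact (I.le_ex_iff hC.1).2 ((I.bottom_rename Fin.castSucc).join (FamLE.refl _) |>.trans hC.1)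
  · have p₀ : M.base.Pt := match M.base with
      | .fin _ => (0 : Fin _)
      | .omega => (0 : ℕ)
    have h := (I.le_ex_iff hC.1).1 (FamLE.refl (Interval.ex C))
    have hu : Computable fun a : Fin k → M.Pt => (Fin.snoc a (fun _ => p₀) : Fin (k + 1) → M.Pt) :=
      computable_snoc.comp (Computable.id.pair (Computable.const _))
    have h' := ((FamLE.join_left _ _).trans h).comap hu
    simp only [Fin.init_snoc] at h'
    exact h'.trans (hC.2.comap hu)

theorem computable_eq {P : Type*} [Primcodable P] {α : Type*} [Primcodable α] {u v : α → P}
    (hu : Computable u) (hv : Computable v) : Computable fun a => encode (u a) == encode (v a) :=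
  (Primrec.beq.to_comp).comp (Computable.encode.comp hu) (Computable.encode.comp hv)

theorem InFibre.eqPred : I.InFibre (I.eqPred M) := by
  have hc := computable_eq (computable_coord (P := M.Pt) (n := 2) 0) (computable_coord 1)
  constructor
  · refine FamLE.cases hc ((FamLE.refl _).mono (fun _ _ h => h) ?_)
      ((I.bottom_le_top 2).mono (fun _ _ h => h) ?_)
    · rintro a f ⟨⟨-, h⟩ | ⟨h, -⟩, h'⟩
      · exact h
      · simp only [beq_iff_eq, encode_inj] at h'; exact absurd h' h
    · rintro a f ⟨⟨h, -⟩ | ⟨-, h⟩, h'⟩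
      · simp [h] at h'
      · exact h
  · refine FamLE.cases hc ?_ ?_
    · refine ((I.bottom_le_top 2).trans (FamLE.refl _) : FamLE (I.bottom (M := M)) _) |> fun h => ?_
      obtain ⟨e, he⟩ := h
      refine ⟨e, fun a f hf => ?_⟩
      have h' : a 0 = a 1 := by simpa using hf.2
      obtain ⟨b, hb, hbc⟩ := he a f hf.1
      exact ⟨b, .inl ⟨h', hb⟩, hbc⟩
    · obtain ⟨e, he⟩ := FamLE.refl (fun _ : Fin 2 → M.Pt => I.top)
      refine ⟨e, fun a f hf => ?_⟩
      have h' : a 0 ≠ a 1 := by simpa using hf.2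
      obtain ⟨b, hb, hbc⟩ := he a f hf.1
      exact ⟨b, .inr ⟨h', hb⟩, hbc⟩

/-- `=_M` is the right adjoint, at the bottom, to reindexing along the diagonal. -/
theorem le_eqPred_iff {C : (Fin 2 → M.Pt) → Problem} (hC : I.InFibre C) :
    FamLE (I.reindex (fun (a : Fin 1 → M.Pt) _ => a 0) C) I.bottom ↔ FamLE C (I.eqPred M) := by
  have hdiag : Computable fun (a : Fin 1 → M.Pt) (_ : Fin 2) => a 0 :=
    computable_tuple fun _ => computable_coord 0
  have hfst : Computable fun (a : Fin 2 → M.Pt) (_ : Fin 1) => a 0 :=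
    computable_tuple fun _ => computable_coord 0
  constructor
  · intro h
    have h' := (((FamLE.join_left _ _).trans h).comap hfst).trans (I.bottom_rename fun _ => 0)
    have hc := computable_eq (computable_coord (P := M.Pt) (n := 2) 0) (computable_coord 1)
    refine FamLE.cases hc ?_ (hC.2.mono (fun _ _ h => h) ?_)
    · obtain ⟨e, he⟩ := h'
      refine ⟨e, fun a f hf => ?_⟩
      have e1 : a 0 = a 1 := by simpa using hf.2
      have e2 : (fun _ => a 0 : Fin 2 → M.Pt) = a := by
        funext i; fin_cases i
        · rfl
        · exact e1
      rcases hf.1 with h | h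
      · simpa only [e2] using he a f h.2
      · exact absurd e1 h.1
    · rintro a f ⟨⟨h, -⟩ | ⟨-, h⟩, h'⟩
      · simp [h] at h'
      · exact h
  · intro h
    refine FamLE.join ((h.comap hdiag).trans ?_) (FamLE.refl _)
    refine (I.bottom_rename fun _ => 0 : FamLE (fun a : Fin 1 → M.Pt => I.bottom fun _ : Fin 2 =>
      a 0) I.bottom).mono ?_ fun _ _ h => h
    intro a f hf
    exact .inl ⟨rfl, hf⟩

namespace Struct

variable {I : Interval} {L : FirstOrder.Language} (M : I.Struct L)

theorem computable_term {n : ℕ} (t : L.Term (Fin n)) : Computable (M.term t) := by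
  induction t with
  | var i => exact computable_coord i
  | func f ts ih =>
    exact ((computable_coord 0).comp (M.funMap_mor f).1).comp (computable_tuple ih)

/-- `⟦φ⟧` is an element of the fibre over `M^n`. -/
theorem interp_mem {n : ℕ} (φ : Formula L n) : I.InFibre (M.interp φ) := by
  induction φ with
  | rel R ts => exact (M.relMap_mem R).reindex (computable_tuple fun i => M.computable_term _)
  | eq t s =>
    refine InFibre.eqPred.reindex ?_
    have := computable_tuple (t := ![M.term t, M.term s]) (by
      intro i; fin_cases i
      · exact M.computable_term t
      · exact M.computable_term s)
    refine this.of_eq fun a => funext fun i => ?_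
    fin_cases i <;> rfl
  | top => exact InFibre.bottom I _
  | bot => exact InFibre.top I _
  | or φ ψ h h' => exact h.meet h'
  | and φ ψ h h' => exact h.join h'
  | imp φ ψ h h' => exact h'.himp
  | ex φ h => exact h.ex
  | all φ h => exact h.all

end Struct

end Interval

end MassProblem

/-! The implication has the shape of the constant domain principle: from S(z) ∨ R for all z one
wants either S(z) for all z, or R. It breaks down as soon as an element of the universe carries
information that is absent from the empty context, as in a Kripke model whose domain grows.

Choose g noncomputable and k not computable from g. Let the universe be {1, 2}, with B_{-1} and B_1
of degree 0, B_2 of the degree of g, and A of the degree of g ⊕ k. So the element 1 comes for free,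
while whoever is given 2 knows g. Let S(z) say z = 1, and let R be {g}.

Both premises are solved uniformly from the bottom. Equality on {1, 2} is decidable, so among any
three elements an equal pair can be found; and S(z) ∨ R is answered on the left at 1 and on the
right at 2, where g can be read off from B_2 (`two_elements_le_bottom`, `all_S_or_R_le_bottom`).

In the empty context only the zero function is available. A computation from one fixed function
yields one fixed answer, so a solution of the disjunction already solves one disjunct
(`FamLE.of_meet`). It cannot be R, as g is noncomputable. If it were ∀z S(z), then S(2) would be
solvable from B_2, that is, from g; but 2 ≠ 1, so S(2) is at least as hard as A, which g does not
compute (`not_all_S_le_zero`). -/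

namespace MassProblem

open Encodable

/-! ### Reductions from a single function -/

/-- Medvedev reducibility is reducibility of families over a one-point index set. -/
theorem medLE_iff {A B : Problem} : MedLE A B ↔ FamLE (fun _ : Unit => A) fun _ => B := by
  constructor
  · rintro ⟨e, he⟩
    have hT : IsFunctional fun g (x : Unit × ℕ) => turing e g x.2 :=
      IsFunctional.turing.precomp (u := fun x : Unit × ℕ => (e, x.2))
        ((Computable.const e).pair Computable.snd)
    exact .of hT fun _ f hf => he f hf
  · intro h
    obtain ⟨F, hF, H⟩ := famLE_iff.1 h
    obtain ⟨φ, -, hφ⟩ := hF.index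
    refine ⟨φ (), fun f hf => ?_⟩
    obtain ⟨h, hh, hk⟩ := H () f hf
    exact ⟨h, hh, fun n => hφ _ _ _ _ (hk n)⟩

/-- No function computes all functions. -/
theorem exists_not_medLE (g : ℕ → ℕ) : ∃ k : ℕ → ℕ, ¬ MedLE {k} {g} := by
  classical
  -- Diagonalisation: where Φ_x(g)(x) converges, k(x) is one more than that value; the default 0 on
  -- divergence is immaterial. An index e with Φ_e(g) = k would be contradicted at the argument e.
  refine ⟨fun x => if h : (turing x g x).Dom then (turing x g x).get h + 1 else 0, ?_⟩
  rintro ⟨e, he⟩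
  obtain ⟨_, rfl, hc⟩ := he g rfl
  obtain ⟨hd, hv⟩ := hc e
  simp [hd] at hv

section
variable {X : Type*} [Primcodable X]

theorem eq_of_encode_beq {p q : X} (h : (encode p == encode q) = true) : p = q :=
  encode_injective (beq_iff_eq.1 h)

theorem ne_of_encode_beq {p q : X} (h : (encode p == encode q) = false) : p ≠ q :=
  fun e => beq_eq_false_iff_ne.1 h (congrArg encode e)

theorem FamLE.zero {D : X → Problem} : FamLE (fun _ => {fun _ => 0}) D :=
  .of (.of_computable (Computable.const 0)) fun _ _ _ => ⟨_, rfl, fun _ => by simp⟩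

/-- Over one point, `A ⊗ B` is prime below the degree of a single function. -/
theorem FamLE.of_meet [Unique X] {A B : X → Problem} {d : ℕ → ℕ}
    (h : FamLE (fun x => MassProblem.meet (A x) (B x)) fun _ => {d}) :
    FamLE A (fun _ => {d}) ∨ FamLE B (fun _ => {d}) := by
  obtain ⟨F, hF, H⟩ := famLE_iff.1 h
  -- This functional drops the leading tag 0 or 1 of the output.
  have hs : IsFunctional fun g (x : X × ℕ) => F g (x.1, x.2 + 1) :=
    hF.precomp (Computable.fst.pair (Computable.succ.comp Computable.snd))
  -- With one index and one oracle there is a single output to inspect, so its tag selects the same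
  -- side for the whole family.
  obtain ⟨_, ⟨f, hf, rfl⟩ | ⟨f, hf, rfl⟩, hk⟩ := H default d rfl
  · refine .inl (.of hs fun x g hg => ?_)
    obtain rfl := Unique.eq_default x
    obtain rfl : g = d := hg
    exact ⟨f, hf, fun n => hk (n + 1)⟩
  · refine .inr (.of hs fun x g hg => ?_)
    obtain rfl := Unique.eq_default x
    obtain rfl : g = d := hg
    exact ⟨f, hf, fun n => hk (n + 1)⟩

end

namespace Interval

/-! ### The interval -/

/-- The interval with `B_{-1}` and `B_1` of degree `0`, all other `B_i` of the degree of `g`, and `A` of the degree of `g ⊕ k`, where `g` does not compute `k`. -/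
def ofPoints (g k : ℕ → ℕ) (hk : ¬ MedLE {k} {g}) : Interval :=
  -- A computation of g ⊕ k from g would yield k, the odd half.
  have hk' : ¬ MedLE {joinFun g k} {g} := fun h => hk <| medLE_iff.2 <|
    FamLE.trans (.of IsFunctional.readOdd fun _ f hf => ⟨k, rfl, fun n => by
      obtain rfl : f = joinFun g k := hf
      simp⟩) (medLE_iff.1 h)
  have hk₀ : ¬ MedLE {joinFun g k} {fun _ => 0} := fun h => hk' <| medLE_iff.2 <|
    (medLE_iff.1 h).trans .zero
  { top := {joinFun g k}
    bot := {fun _ => 0}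
    -- Elements of {1, 2} are numbered from 1, so only B_1 and B_2 enter the structure below.
    dom := fun i => {f | (i = 1 ∧ f = fun _ => 0) ∨ (i ≠ 1 ∧ f = g)}
    bot_le := .zero
    le_top := by
      have hc : Computable fun i : ℕ => i == 1 :=
        (Primrec.beq.to_comp).comp Computable.id (Computable.const 1)
      refine FamLE.cases hc ?_ ?_
      · refine .of (.of_computable (Computable.const 0)) fun i f hf => ?_
        exact ⟨_, .inl ⟨by simpa using hf.2, rfl⟩, fun _ => by simp⟩
      · refine .of IsFunctional.readEven fun i f hf => ?_
        obtain rfl : f = joinFun g k := hf.1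
        exact ⟨g, .inr ⟨by simpa using hf.2, rfl⟩, fun _ => by simp⟩
    not_top_le_bot := hk₀
    not_top_le_dom := fun i h => by
      by_cases hi : i = 1
      · simp only [hi, true_and, ne_eq, not_true_eq_false, false_and, or_false] at h
        exact hk₀ h
      · simp only [hi, false_and, ne_eq, not_false_eq_true, true_and, false_or] at h
        exact hk' h }

/-! ### Validity of universal closures and of equations, in any interval -/

variable {I : Interval} {M : Obj}

/-- A valid formula has a valid universal closure. -/
theorem all_le_bottom {k : ℕ} {C : (Fin (k + 1) → M.Pt) → Problem} (h : FamLE C I.bottom) :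
    FamLE (I.all C) I.bottom :=
  -- By the adjunction it is enough to solve C from the weakened bottom, whose right half is the
  -- bottom of the larger context.
  (I.all_le_iff (FamLE.refl _)).2 (h.trans (FamLE.join_right _ _))

/-- `s = t` holds wherever `s` and `t` agree. -/
theorem reindex_eqPred_le {k : ℕ} {s t : (Fin k → M.Pt) → M.Pt} (hs : Computable s)
    (h : FamLE (fun a => I.bottom fun _ : Fin 1 => s a) I.bottom) :
    FamLE (I.reindex (fun a => ![s a, t a]) (I.eqPred M)) fun a =>
      {f | f ∈ I.bottom a ∧ s a = t a} := by
  have hu : Computable fun a (_ : Fin 1) => s a := computable_tuple fun _ => hs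
  -- B_{(s,s)} ≤ B_s ≤ B_a. Where s and t agree, B_{(s,t)} is the same set as B_{(s,s)}, so nothing
  -- is required of t.
  have h' := ((I.bottom_rename (M := M) fun _ : Fin 2 => (0 : Fin 1)).comap hu).trans h
  refine FamLE.join ?_ ((FamLE.refl _).mono (fun _ _ h => h) fun _ _ h => h.1)
  obtain ⟨e, he⟩ := h'
  refine ⟨e, fun a f hf => ?_⟩
  obtain ⟨b, hb, hbc⟩ := he a f hf.1
  have e : (fun _ => s a : Fin 2 → M.Pt) = ![s a, t a] := by
    funext i; fin_cases i
    · rfl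
    · exact hf.2
  refine ⟨b, .inl ⟨hf.2, ?_⟩, hbc⟩
  change b ∈ I.bottom ![s a, t a]
  rw [← e]
  exact hb

/-- `x_i = x_j` holds wherever the coordinates agree. -/
theorem reindex_coord_eqPred_le {k : ℕ} (i j : Fin k) :
    FamLE (I.reindex (fun a => ![a i, a j]) (I.eqPred M)) fun a =>
      {f | f ∈ I.bottom a ∧ a i = a j} :=
  reindex_eqPred_le (computable_coord i) (I.bottom_rename fun _ => i)

/-! ### The universe {1, 2} and the information carried by its elements -/

/-- The universe `{1, 2}`. -/
abbrev twoPoints : Obj := ⟨.fin 1, 1⟩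

/-- The number `1` as an element of `{1, 2}`. -/
def one : twoPoints.Pt := fun _ => (0 : Fin 2)

/-- The number `2` as an element of `{1, 2}`. -/
def two : twoPoints.Pt := fun _ => (1 : Fin 2)

theorem eq_one_or_two (p : twoPoints.Pt) : p = one ∨ p = two := by
  have h : ∀ i : Fin 2, i = 0 ∨ i = 1 := by decide
  refine (h (p 0)).imp (fun h => ?_) fun h => ?_ <;>
  · funext i
    obtain rfl : i = 0 := Subsingleton.elim _ _
    exact h

theorem one_ne_two : one ≠ two := fun h => absurd (congrFun h 0) (by decide : (0 : Fin 2) ≠ 1)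

section
variable {g k : ℕ → ℕ} {hk : ¬ MedLE {k} {g}}

/-- `g` is computable from the element `2`, and trivially from `A`. -/
theorem point_le_bottom_two :
    FamLE (fun _ : Fin 1 → twoPoints.Pt => {g}) fun a =>
      {f | f ∈ (ofPoints g k hk).bottom a ∧ a 0 = two} := by
  -- Column `Nat.pair i j + 1` of a solution of B_a solves B for the j-th coordinate of a_i, column
  -- 0 being reserved for B_{-1}. Here i = j = 0 is the only choice, and B_2 = {g}.
  refine .of (.readPF (u := fun n => Nat.pair (Nat.pair 0 0 + 1) n)
    ((Primrec₂.natPair.to_comp).comp (Computable.const _) Computable.id)) fun a f hf => ?_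
  refine ⟨g, rfl, fun n => ?_⟩
  obtain ⟨⟨-, h⟩, ha⟩ := hf
  rcases h 0 0 with ⟨h, -⟩ | ⟨-, h⟩
  · rw [ha] at h; exact absurd h (by decide)
  · simpa [col] using (congrFun h n).symm

/-- The zero function solves the bottom element of the fibre over a point. -/
theorem bottom_le_zero : FamLE (ofPoints g k hk).bottom
    fun _ : Fin 0 → twoPoints.Pt => {fun _ => 0} := by
  refine (FamLE.refl _).mono (fun a f hf => ?_) fun _ _ h => h
  obtain rfl := hf
  -- The empty context has no coordinates, so only column 0 is constrained.
  exact ⟨rfl, fun i => i.elim0⟩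

/-- `g` computes every element of `{1, 2}`. -/
theorem bottom_le_point (a : Fin 1 → twoPoints.Pt) :
    FamLE (fun _ : Unit => (ofPoints g k hk).bottom a) fun _ => {g} := by
  have hp : a 0 = one ∨ a 0 = two := eq_one_or_two _
  have e : ∀ i j, a i j = a 0 0 := fun i j => by
    rw [Subsingleton.elim i 0, Subsingleton.elim j 0]
  rcases hp with h | h
  · refine .of (.of_computable (Computable.const 0)) fun _ f _ => ⟨fun _ => 0, ⟨rfl, ?_⟩, by simp⟩
    exact fun i j => .inl ⟨by rw [e i j, h]; rfl, rfl⟩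
  · have hc : Computable fun x : Unit × ℕ => x.2.unpair.1 == 0 :=
      (Primrec.beq.to_comp).comp (Computable.fst.comp (Computable.unpair.comp Computable.snd))
        (Computable.const 0)
    have hr : IsFunctional (readPF Unit fun n => n.unpair.2) :=
      .readPF (Computable.snd.comp Computable.unpair)
    refine .of ((IsFunctional.of_computable (Computable.const 0)).cond hr hc) fun _ f hf => ?_
    -- Column 0 must be the zero function, as it solves B_{-1}. Every other column is a copy of g,
    -- which covers the one that has to solve B_2.
    refine ⟨fun n => bif n.unpair.1 == 0 then 0 else f n.unpair.2, ⟨?_, fun i j => .inr ⟨?_, ?_⟩⟩,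
      fun n => ?_⟩
    · change _ = _
      funext m; simp [col]
    · rw [e i j, h]; decide
    · rw [← Set.mem_singleton_iff.1 hf]; funext m; simp [col]
    · cases hn : n.unpair.1 == 0 <;> simp [hn]

/-! ### The structure -/

/-- The predicate `z = 1`. -/
def isOne (I : Interval) : (Fin 1 → twoPoints.Pt) → Problem :=
  I.reindex (fun a => ![a 0, one]) (I.eqPred _)

/-- Computability of z ↦ (z, 1) suffices: reindexing joins with B_z, so no bound on B_{(z,1)} is
needed and the interval may be arbitrary. -/
theorem isOne_mem (I : Interval) : I.InFibre I.isOne := by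
  have h : Computable fun (a : Fin 1 → twoPoints.Pt) (i : Fin 2) => ![a 0, one] i := by
    refine computable_tuple (t := fun i (a : Fin 1 → twoPoints.Pt) => ![a 0, one] i) fun i => ?_
    fin_cases i
    · exact computable_coord 0
    · exact Computable.const one
  exact (InFibre.eqPred (I := I) (M := twoPoints)).reindex h

/-- The bottom over the empty context is solved by the zero function, hence lies below everything,
and g is the even half of the element g ⊕ k of A. -/
theorem point_mem : (ofPoints g k hk).InFibre fun _ : Fin 0 → twoPoints.Pt => {g} := by
  refine ⟨bottom_le_zero.trans .zero, .of IsFunctional.readEven fun a f hf => ?_⟩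
  obtain rfl : f = joinFun g k := hf
  exact ⟨g, rfl, fun _ => by simp⟩

/-- The interpretations of the relation symbols: `S(z)` is `z = 1` and `R` is `{g}`. -/
def cdRelMap (I : Interval) (g : ℕ → ℕ) : {n : ℕ} → CDRel n → (Fin n → twoPoints.Pt) → Problem
  | _, .R => fun _ => {g}
  | _, .S => I.isOne

/-- The structure with universe `{1, 2}` in which `S(z)` is `z = 1` and `R` is `{g}`. -/
def ofPointsStruct (g k : ℕ → ℕ) (hk : ¬ MedLE {k} {g}) : (ofPoints g k hk).Struct cdLang where
  univ := twoPoints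
  funMap := fun f => f.elim
  funMap_mor := fun f => f.elim
  relMap := (ofPoints g k hk).cdRelMap g
  relMap_mem := fun
    | .R => point_mem
    | .S => isOne_mem _

/-! ### The premises hold -/

/-- At z = 1 the predicate equates equal terms, so B_z solves it. The side condition empties the
right-hand family at z = 2, where S demands a solution of A. -/
theorem interp_S_le : FamLE ((ofPointsStruct g k hk).interp (cdS (0 : Fin 1))) fun a =>
    {f | f ∈ (ofPoints g k hk).bottom a ∧ a 0 = one} := by
  have h : FamLE (ofPoints g k hk).isOne fun a =>
      {f | f ∈ (ofPoints g k hk).bottom a ∧ a 0 = one} :=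
    reindex_eqPred_le (computable_coord 0) ((ofPoints g k hk).bottom_rename fun _ => 0)
  refine FamLE.join (FamLE.trans ?_ h) ((FamLE.refl _).mono (fun _ _ h => h) fun _ _ h => h.1)
  refine (FamLE.refl _).mono (fun a f hf => ?_) fun _ _ h => h
  -- The atomic formula reindexes z = 1 once more, along the identity of one-tuples.
  have e : (fun _ => a 0 : Fin 1 → twoPoints.Pt) = a := by
    funext i
    obtain rfl : i = 0 := Subsingleton.elim _ _
    rfl
  change f ∈ (ofPoints g k hk).isOne fun _ => a 0
  rw [e]
  exact hf

/-- `∀ x y z, (x = y ∨ x = z ∨ y = z)` holds on `{1, 2}`. -/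
theorem two_elements_le_bottom : FamLE ((ofPointsStruct g k hk).interp
    (.all (.all (.all (.or (.eq (cdVar 0) (cdVar 1))
        (.or (.eq (cdVar 0) (cdVar 2)) (.eq (cdVar 1) (cdVar 2)))))) : Formula cdLang 0))
    (ofPoints g k hk).bottom := by
  refine all_le_bottom (all_le_bottom (all_le_bottom ?_))
  have h := fun i j : Fin 3 => reindex_coord_eqPred_le (I := ofPoints g k hk)
    (M := twoPoints) i j
  -- Comparing codes decides equality of points, so the true disjunct is chosen uniformly in the
  -- triple.
  refine FamLE.cases (computable_eq (computable_coord 0) (computable_coord 1))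
    ((FamLE.meet_left _ _).trans ((h 0 1).mono (fun _ _ h => h) ?_))
    ((FamLE.meet_right _ _).trans ?_)
  · rintro a f ⟨hf, h⟩
    exact ⟨hf, eq_of_encode_beq h⟩
  refine FamLE.cases (computable_eq (computable_coord 0) (computable_coord 2))
    ((FamLE.meet_left _ _).trans ((h 0 2).mono (fun _ _ h => h) ?_))
    ((FamLE.meet_right _ _).trans ((h 1 2).mono (fun _ _ h => h) ?_))
  · rintro a f ⟨⟨hf, -⟩, h⟩
    exact ⟨hf, eq_of_encode_beq h⟩
  · rintro a f ⟨⟨hf, h1⟩, h2⟩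
    have h1 : a 0 ≠ a 1 := ne_of_encode_beq h1
    have h2 : a 0 ≠ a 2 := ne_of_encode_beq h2
    refine ⟨hf, ?_⟩
    -- Pigeonhole: the second and third elements both differ from the first, hence coincide.
    rcases eq_one_or_two (a 0) with e0 | e0 <;> rcases eq_one_or_two (a 1) with e1 | e1 <;>
      rcases eq_one_or_two (a 2) with e2 | e2 <;> simp_all

/-- `∀ z, (S z ∨ R)` holds: `z = 1` solves `S z`, and `z = 2` computes the solution of `R`. -/
theorem all_S_or_R_le_bottom : FamLE ((ofPointsStruct g k hk).interp
    (.all (.or (cdS 0) cdR) : Formula cdLang 0)) (ofPoints g k hk).bottom := by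
  refine all_le_bottom ?_
  refine FamLE.cases (computable_eq (computable_coord 0) (Computable.const one))
    ((FamLE.meet_left _ _).trans (interp_S_le.mono (fun _ _ h => h) ?_))
    -- In the context z the formula R is interpreted by {g} ⊕ B_z, hence the second half.
    ((FamLE.meet_right _ _).trans (FamLE.join ((point_le_bottom_two (hk := hk)).mono (fun _ _ h => h) ?_)
      ((FamLE.refl _).mono (fun _ _ h => h) fun _ _ h => h.1)))
  · rintro a f ⟨hf, h⟩
    exact ⟨hf, eq_of_encode_beq h⟩
  · rintro a f ⟨hf, h⟩
    exact ⟨hf, (eq_one_or_two _).resolve_left (ne_of_encode_beq h)⟩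

/-! ### The conclusion fails -/

/-- `S 2` has degree at least `A`, which `g` does not compute. -/
theorem not_all_S_le_zero : ¬ FamLE ((ofPointsStruct g k hk).interp
    (.all (cdS 0) : Formula cdLang 0)) fun _ => {fun _ => 0} := by
  intro h
  -- The adjunction for ∀, specialised to z = 2: S(2) is solvable from the zero function joined with
  -- B_2.
  have h1 := (((ofPoints g k hk).all_le_iff bottom_le_zero).1 h).comap
    (u := fun _ : Unit => fun _ : Fin 1 => two) (Computable.const _)
  have h2 : FamLE (fun _ : Unit => {joinFun g k}) fun _ =>
      (ofPointsStruct g k hk).interp (cdS (0 : Fin 1)) fun _ => two := by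
    -- Two copies of B_z are discarded, one from the atomic formula and one from the definition of z
    -- = 1. What remains is equality at the pair (2, 1), off the diagonal, which is A.
    refine (((FamLE.join_left _ _).trans (FamLE.join_left _ _)).mono ?_ fun _ _ h => h)
    rintro - f (⟨h, -⟩ | ⟨-, h⟩)
    · exact absurd h.symm one_ne_two
    · exact h
  -- Chaining the reductions, g computes A; but B_2 = {g}.
  exact (ofPoints g k hk).not_top_le_dom 2 <| medLE_iff.2 <| by
    refine (h2.trans (h1.trans (FamLE.join .zero (bottom_le_point _)))).mono (fun _ _ h => h) ?_
    rintro - f (⟨h, -⟩ | ⟨-, h⟩)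
    · exact absurd h (by decide)
    · exact h

theorem not_R_le_zero (hg : ¬ MedLE {g} {fun _ => 0}) : ¬ FamLE ((ofPointsStruct g k hk).interp (cdR : Formula cdLang 0))
    fun _ => {fun _ => 0} := fun h => hg <| medLE_iff.2 <|
  ((FamLE.join_left _ _).trans h).comap (u := fun _ : Unit => Fin.elim0) (Computable.const _)

/-- An implication is satisfied exactly when its conclusion reduces to its premise joined with the
bottom. The premise here is itself at the bottom, so the disjunction would be solvable from the zero
function, and then so would one of its disjuncts. -/
theorem ofPointsStruct_not_satisfies (hg : ¬ MedLE {g} {fun _ => 0}) :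
    ¬ (ofPointsStruct g k hk).Satisfies cdFormula := by
  intro h
  have h1 := ((ofPoints g k hk).himp_le_iff (FamLE.refl _)).1 h
  have h2 := h1.trans ((two_elements_le_bottom.join all_S_or_R_le_bottom).join (FamLE.refl _))
  exact (h2.trans bottom_le_zero).of_meet.elim not_all_S_le_zero (not_R_le_zero hg)

end

end Interval

end MassProblem

theorem mainTheorem11 :
    ∃ (I : MassProblem.Interval) (M : I.Struct MassProblem.cdLang),
      ¬ M.Satisfies MassProblem.cdFormula := by
  -- Two diagonalisations: g is not computable from the zero function, and k is not computable from
  -- g.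
  obtain ⟨g, hg⟩ := MassProblem.exists_not_medLE fun _ => 0
  obtain ⟨k, hk⟩ := MassProblem.exists_not_medLE g
  exact ⟨_, _, MassProblem.Interval.ofPointsStruct_not_satisfies (hk := hk) hg⟩
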